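/- Strings are elements of $\{0,1\}^*$. An \emph{$m$-oracle protocol} consists of the following. (i) A querier $A$: a probabilistic interactive multitape Turing machine with an input tape, a random tape $R_A$ of independent fair coin tosses, an output tape, and $m$ communication channels. $A$ works in rounds: in each round it sends one message on every channel and then receives one reply on every channel. Finally it halts. There is a polynomial $p$ such that on every input $x$, for every random tape and whatever replies it receives, $A$ halts after at most $p(|x|)$ steps in total (so the number of rounds is also at most $p(|x|)$). (ii) Random variables $O_1,\dots,O_m$ (the oracle tapes) with values in the subsets of $\{0,1\}^*$ and an arbitrary joint law, jointly independent of the input and of $R_A$. (iii) Players $B_1,\dots,B_m$: deterministic oracle Turing machines, with no bound on time or space, where $B_i$ has oracle $O_i$. In round $r$, $B_i$ computes its reply from the sequence $y_{1,i},\dots,y_{r,i}$ of messages that it has received so far; it always halts. Let $Y_i$ denote the sequence of all messages sent by $A$ to $B_i$. The protocol is a \emph{model-2 instance-hiding scheme} for $f:\{0,1\}^*\to\{0,1\}^*$ that \emph{leaks at most $|x|$} if - on every input $x$, for all contents of the oracle tapes and of the random tape, $A$ outputs $f(x)$ (no error is allowed); and - for every $i$, every probability distribution of the input $X$ on $\{0,1\}^*$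 and every $n\in\mathbb{N}$ with $\Pr[|X|=n]>0$, the random variables $X$ and $\langle Y_i,O_i\rangle$ are independent conditionally on $|X|=n$. \textbf{Theorem.} (1) Let $f:\{0,1\}^*\to\{0,1\}^*$ be any function for which there is a polynomial $q$ with $|f(x)|\le q(|x|)$ for all $x$. Then $f$ has a model-2 $2$-oracle instance-hiding scheme that leaks at most $|x|$. (2) Conversely, two oracles are necessary for most boolean functions: let $f:\{0,1\}^*\to\{0,1\}$ be chosen at random by tossing an independent fair coin for each value $f(x)$ (equivalently, according to Lebesgue measure on $[0,1]$, by reading the bits of a real number as the values of $f$). Then with probability one $f$ has no $1$-oracle instance-hiding scheme that leaks at most $|x|$. -/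

import Mathlib

/-- What a machine does at the end of a step: keep computing, become inactive (its outgoing
messages are delivered and it is awoken by the replies), or halt. -/
inductive Signal where
  | run
  | send
  | halt

/-- One instruction of a multitape machine with `tapes + 1` work tapes and `m` communication
channels. -/
structure Instruction (states tapes m : ℕ) where
  /-- the next state of the finite control -/
  next : Fin states
  /-- the symbol (`none` is the blank) written on each work tape -/
  write : Fin (tapes + 1) → Option Bool
  /-- the move of each work head (`none`: the head stays) -/
  move : Fin (tapes + 1) → Option Turing.Dir
  /-- whether the one-way head of the random tape advances -/
  advanceCoin : Bool
  /-- whether the one-way head of each incoming communication tape advances -/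
  advanceIn : Fin m → Bool
  /-- the bit, if any, appended to each outgoing communication tape -/
  emit : Fin m → Option Bool
  /-- the bit, if any, appended to the output tape -/
  print : Option Bool
  /-- keep running, become inactive, or halt -/
  signal : Signal

/-- A probabilistic interactive multitape Turing machine over the alphabet `{0, 1, blank}`, with a
finite control, `tapes + 1` two-way work tapes (the input is initially on tape number `0`), a
random tape with a unidirectional read head, `m` communication channels, each consisting of a
read-only incoming tape and a write-only outgoing tape, and a write-only output tape. -/
structure Machine (m : ℕ) where
  /-- the number of states -/
  states : ℕ
  /-- the number of work tapes in addition to tape number `0` -/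
  tapes : ℕ
  /-- the initial state -/
  start : Fin states
  /-- the transition function, given the state, the scanned symbols of the work tapes, the scanned
  bit of the random tape and the scanned symbols of the incoming tapes (`none` at the end of the
  message) -/
  trans : Fin states → (Fin (tapes + 1) → Option Bool) → Bool → (Fin m → Option Bool) →
    Instruction states tapes m

namespace Machine

variable {m : ℕ}

/-- Configurations. -/
structure Config (M : Machine m) where
  /-- state of the finite control -/
  state : Fin M.states
  /-- work tapes with their heads -/
  tape : Fin (M.tapes + 1) → Turing.Tape (Option Bool)
  /-- unread part of the random tape -/
  coins : ℕ → Bool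
  /-- unread part of the last message received on each channel -/
  inbox : Fin m → List Bool
  /-- message being written on each channel -/
  outbox : Fin m → List Bool
  /-- the messages sent so far on each channel, in chronological order -/
  sent : Fin m → List (List Bool)
  /-- output written so far -/
  output : List Bool
  /-- whether the machine has halted -/
  halted : Bool

/-- The initial configuration on input `x` and random tape `ρ`. -/
def init (M : Machine m) (x : List Bool) (ρ : ℕ → Bool) : M.Config where
  state := M.start
  tape := fun j => if j = 0 then Turing.Tape.mk₁ (x.map some) else Turing.Tape.mk₁ []
  coins := ρ
  inbox := fun _ => []
  outbox := fun _ => []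
  sent := fun _ => []
  output := []
  halted := false

/-- One step, where `env i ys` is the reply received on channel `i` when `ys` is the sequence of
all messages sent on channel `i` up to and including the current round. A halted machine stays as
it is. When the machine becomes inactive, one message is sent on every channel, and every incoming
tape is overwritten with the reply. -/
def step (M : Machine m) (env : Fin m → List (List Bool) → List Bool) (c : M.Config) : M.Config :=
  if c.halted then c
  else
    let a := M.trans c.state (fun j => (c.tape j).head) (c.coins 0) (fun i => (c.inbox i).head?)
    let tape' : Fin (M.tapes + 1) → Turing.Tape (Option Bool) := fun j =>
      match a.move j with
      | none => (c.tape j).write (a.write j)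
      | some d => ((c.tape j).write (a.write j)).move d
    let coins' : ℕ → Bool := if a.advanceCoin then fun k => c.coins (k + 1) else c.coins
    let inbox' : Fin m → List Bool := fun i =>
      if a.advanceIn i then (c.inbox i).tail else c.inbox i
    let outbox' : Fin m → List Bool := fun i => c.outbox i ++ (a.emit i).toList
    let output' : List Bool := c.output ++ a.print.toList
    match a.signal with
    | Signal.run => ⟨a.next, tape', coins', inbox', outbox', c.sent, output', false⟩
    | Signal.send =>
        ⟨a.next, tape', coins', fun i => env i (c.sent i ++ [outbox' i]), fun _ => [],
          fun i => c.sent i ++ [outbox' i], output', false⟩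
    | Signal.halt => ⟨a.next, tape', coins', inbox', outbox', c.sent, output', true⟩

/-- The configuration after `t` steps. -/
def runFor (M : Machine m) (env : Fin m → List (List Bool) → List Bool) (x : List Bool)
    (ρ : ℕ → Bool) (t : ℕ) : M.Config :=
  (M.step env)^[t] (M.init x ρ)

/-- `M` runs in time `p`: on every input `x`, for every content of the random tape and whatever
replies it receives, `M` halts after a total of at most `p(|x|)` steps. -/
def RunsInTime (M : Machine m) (p : Polynomial ℕ) : Prop :=
  ∀ (env : Fin m → List (List Bool) → List Bool) (x : List Bool) (ρ : ℕ → Bool),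
    (M.runFor env x ρ (p.eval x.length)).halted = true

end Machine

/-- The content of an oracle tape: an arbitrary subset of `{0,1}*`, as a characteristic
function. -/
abbrev Oracle : Type := List Bool → Bool

/-- A deterministic oracle Turing machine with oracle `o` on input `w`, after `t` steps. The single
channel of the machine is its query tape: a query `q` is answered by the bit `o q`. It gets no
randomness besides its oracle (its random tape is constantly zero). -/
def Machine.oracleRun (N : Machine 1) (o : Oracle) (w : List Bool) (t : ℕ) : N.Config :=
  N.runFor (fun _ qs => [o (qs.getLastD [])]) w (fun _ => false) t

/-- `N` with oracle `o` halts on input `w`. There is no bound on time or space. -/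
def Machine.OracleHalts (N : Machine 1) (o : Oracle) (w : List Bool) : Prop :=
  ∃ t, (N.oracleRun o w t).halted = true

open Classical in
/-- The output of `N` with oracle `o` on input `w` (used only where `N` halts). -/
noncomputable def Machine.oracleOutput (N : Machine 1) (o : Oracle) (w : List Bool) : List Bool :=
  if h : N.OracleHalts o w then (N.oracleRun o w (Nat.find h)).output else []

/-- Self-delimiting binary encoding of a finite sequence of messages: a bit `b` becomes `1b`, and
every message is ended by `0`. -/
def encodeMessages (ys : List (List Bool)) : List Bool :=
  ys.flatMap fun y => (y.flatMap fun b => [true, b]) ++ [false]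

/-- The law of a family of independent fair coin tosses indexed by `ι`. -/
noncomputable def fairCoins (ι : Type) : MeasureTheory.Measure (ι → Bool) :=
  MeasureTheory.Measure.infinitePi fun _ : ι => (PMF.uniformOfFintype Bool).toMeasure

/-- Finite strings, and finite sequences of strings, form countable discrete spaces. -/
instance instMeasurableSpaceBitString : MeasurableSpace (List Bool) := ⊤

instance instMeasurableSpaceMessages : MeasurableSpace (List (List Bool)) := ⊤

/-- The players of an `m`-oracle protocol: a probabilistic polynomial-time querier `A`, and
time-unbounded players `B i`, each a deterministic oracle machine with its own oracle tape `O i`.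
The oracle tapes are random variables, with an arbitrary joint law that does not depend on the
input or on the random tape of the querier. On the sequence of messages received so far,
`B i` always computes a reply. -/
structure Protocol (m : ℕ) where
  /-- the querier -/
  A : Machine m
  /-- a bound on the running time of the querier -/
  time : Polynomial ℕ
  runsInTime : A.RunsInTime time
  /-- the probability space of the oracle tapes -/
  Ω : Type
  [measurableSpace : MeasurableSpace Ω]
  /-- its probability measure -/
  P : MeasureTheory.Measure Ω
  [isProbabilityMeasure : MeasureTheory.IsProbabilityMeasure P]
  /-- the oracle tapes -/
  O : Fin m → Ω → Oracle
  measurable_O : ∀ i, Measurable (O i)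
  /-- the finite controls of the oracle players -/
  B : Fin m → Machine 1
  total : ∀ i ω ys, (B i).OracleHalts (O i ω) (encodeMessages ys)

attribute [instance] Protocol.measurableSpace Protocol.isProbabilityMeasure

namespace Protocol

variable {m : ℕ}

/-- The reply of player `B i`, whose oracle tape is `O i ω`, after having received the messages
`ys`. -/
noncomputable def reply (S : Protocol m) (ω : S.Ω) (i : Fin m) (ys : List (List Bool)) :
    List Bool :=
  (S.B i).oracleOutput (S.O i ω) (encodeMessages ys)

/-- The final configuration of the querier in the execution with input `x`, oracle tapes `O i ω`
and random tape `ρ`. -/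
noncomputable def final (S : Protocol m) (x : List Bool) (ω : S.Ω) (ρ : ℕ → Bool) : S.A.Config :=
  S.A.runFor (S.reply ω) x ρ (S.time.eval x.length)

/-- The sequence of messages that the querier sends to player `B i`. -/
noncomputable def queries (S : Protocol m) (i : Fin m) (x : List Bool) (ω : S.Ω) (ρ : ℕ → Bool) :
    List (List Bool) :=
  (S.final x ω ρ).sent i

/-- The querier always outputs `f x`; no error is allowed. -/
def Computes (S : Protocol m) (f : List Bool → List Bool) : Prop :=
  ∀ x ω ρ, (S.final x ω ρ).output = f x

/-- Model 2 (no collusion): the protocol leaks at most `L` to player `B i` if, for every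
distribution `X` of the input and every `u` in the range of `L`, the input and the pair formed by
the messages sent to `B i` and the oracle tape of `B i` are independent given `L(X) = u`. (If that
event has probability zero, there is nothing to check.) -/
def LeaksAtMost {α : Type} (S : Protocol m) (L : List Bool → α) (i : Fin m) : Prop :=
  ∀ (X : MeasureTheory.Measure (List Bool)) [MeasureTheory.IsProbabilityMeasure X],
    ∀ u ∈ Set.range L,
      ProbabilityTheory.IndepFun
        (fun e : List Bool × S.Ω × (ℕ → Bool) => e.1)
        (fun e : List Bool × S.Ω × (ℕ → Bool) => (S.queries i e.1 e.2.1 e.2.2, S.O i e.2.1))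
        (ProbabilityTheory.cond (X.prod (S.P.prod (fairCoins ℕ)))
          {e : List Bool × S.Ω × (ℕ → Bool) | L e.1 = u})

end Protocol

/-- `f` has a model-2 `m`-oracle instance-hiding scheme that leaks at most `|x|` (to each of the
oracle players). -/
def HasInstanceHidingScheme (m : ℕ) (f : List Bool → List Bool) : Prop :=
  ∃ S : Protocol m, S.Computes f ∧ ∀ i, S.LeaksAtMost List.length i

/-- The length of `f x` is bounded by a polynomial in the length of `x`. -/
def PolynomiallyBoundedOutput (f : List Bool → List Bool) : Prop :=
  ∃ p : Polynomial ℕ, ∀ x, (f x).length ≤ p.eval x.length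

/-!
Two oracles suffice. The oracle tapes are made from two random sequences `r`, `q` of bits and a
random table `s`. The first tape holds `r` and a table `h`, the second one `q` and `s`, where
`h w = f (w ⊕ q) ⊕ s (w ⊕ q ⊕ r)` (`TwoOracle.twist`; values of `f` are encoded as bit sequences by
`codeBit`). The querier obtains `q` from the second player and sends `x ⊕ q` to the first one, and
conversely sends `x ⊕ r` to the second one. The rows `h (x ⊕ q)` and `s (x ⊕ r)` that are returned
then xor to `f x`. The second player sees `q`, `s` and `x ⊕ r`, and `r` is uniform and independent of
`q` and `s`, so that translating `r` turns this view for one input into the view for another input of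
the same length. The map `(r, q, s) ↦ (r, q, h)` preserves the measure
(`TwoOracle.measurePreserving_twist`), so the same argument applies to the first player. As a player
only looks up a bit that depends on its messages, it can be the machine `askInput`, which asks its
oracle about its own input. The querier has to halt in polynomial time whatever it is told. This is
ensured by a clock of `k` tapes, an odometer that makes exactly `(|x| + 2) ^ k` steps
(`querier.Ticking.step`).

One oracle does not suffice. In a one-oracle scheme that leaks only the length, there are a content
of the oracle tape and a sequence of messages that are compatible with all inputs of length `n`
(`Protocol.exists_common_queries`). Since the querier never errs, these messages and the parts of the
replies that the querier has time to read determine `f` on all strings of length `n`. For a fixed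
querier and time bound, these are polynomially many bits of advice, but a random `f` has `2 ^ n`
random bits on these strings. Hence the functions that have a scheme with a given querier and a given
time bound form a null set (`fairCoins_eq_zero_of_advice`), and there are only countably many queriers
and time bounds.
-/

open MeasureTheory ProbabilityTheory
open scoped Topology ENNReal

/-! ### Runs of machines -/

namespace Machine

variable {m : ℕ}

theorem step_of_halted (M : Machine m) (env : Fin m → List (List Bool) → List Bool) {c : M.Config}
    (h : c.halted = true) : M.step env c = c := by
  simp [step, h]

theorem runFor_succ (M : Machine m) (env : Fin m → List (List Bool) → List Bool) (x : List Bool)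
    (ρ : ℕ → Bool) (t : ℕ) :
    M.runFor env x ρ (t + 1) = M.step env (M.runFor env x ρ t) :=
  Function.iterate_succ_apply' _ _ _

theorem runFor_eq_of_halted (M : Machine m) {env : Fin m → List (List Bool) → List Bool}
    {x : List Bool} {ρ : ℕ → Bool} {t s : ℕ} (h : (M.runFor env x ρ t).halted = true)
    (hts : t ≤ s) : M.runFor env x ρ s = M.runFor env x ρ t := by
  induction s, hts using Nat.le_induction with
  | base => rfl
  | succ s _ ih => rw [runFor_succ, ih, step_of_halted M env h]

theorem oracleOutput_eq (N : Machine 1) {o : Oracle} {w : List Bool} {t : ℕ}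
    (h : (N.oracleRun o w t).halted = true) :
    N.oracleOutput o w = (N.oracleRun o w t).output := by
  classical
  have hh : N.OracleHalts o w := ⟨t, h⟩
  rw [oracleOutput, dif_pos hh]
  have := N.runFor_eq_of_halted (Nat.find_spec hh) (Nat.find_min' hh h)
  exact (congrArg Config.output this).symm

/-- The sequence of messages on channel `i`, up to and including the current round, if the machine
sends its messages in the next step. -/
def outgoing (M : Machine m) (c : M.Config) (i : Fin m) : List (List Bool) :=
  c.sent i ++ [c.outbox i ++ ((M.trans c.state (fun j => (c.tape j).head) (c.coins 0)
    (fun i => (c.inbox i).head?)).emit i).toList]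

theorem step_congr (M : Machine m) {env env' : Fin m → List (List Bool) → List Bool} {c : M.Config}
    (h : ∀ i, env i (M.outgoing c i) = env' i (M.outgoing c i)) :
    M.step env c = M.step env' c := by
  have h' := funext h
  simp only [outgoing] at h'
  simp only [step, h']

/-- A bounded computation inspects finitely many replies, so it is locally constant in a parameter
of which every single reply is a locally constant function. -/
theorem eventually_runFor_eq {α : Type*} [TopologicalSpace α] (M : Machine m)
    (env : α → Fin m → List (List Bool) → List Bool) (o₀ : α)
    (h : ∀ i ys, ∀ᶠ o in 𝓝 o₀, env o i ys = env o₀ i ys) (x : List Bool) (ρ : ℕ → Bool) (t : ℕ) :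
    ∀ᶠ o in 𝓝 o₀, M.runFor (env o) x ρ t = M.runFor (env o₀) x ρ t := by
  induction t with
  | zero => exact Filter.Eventually.of_forall fun _ => rfl
  | succ t ih =>
    have h' : ∀ᶠ o in 𝓝 o₀, ∀ i, env o i (M.outgoing (M.runFor (env o₀) x ρ t) i) =
        env o₀ i (M.outgoing (M.runFor (env o₀) x ρ t) i) :=
      Filter.eventually_all.2 fun i => h i _
    filter_upwards [ih, h'] with o h1 h2
    rw [runFor_succ, runFor_succ, h1]
    exact M.step_congr h2

/-- Where it is defined, the output of an oracle machine depends on finitely many bits of the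
oracle. -/
theorem eventually_oracleOutput_eq (N : Machine 1) {o₀ : Oracle} {w : List Bool}
    (h : N.OracleHalts o₀ w) : ∀ᶠ o in 𝓝 o₀, N.oracleOutput o w = N.oracleOutput o₀ w := by
  obtain ⟨t, ht⟩ := h
  have := N.eventually_runFor_eq (fun (o : Oracle) _ qs => [o (qs.getLastD [])]) o₀
    (fun _ qs => by
      have hc : ContinuousAt (fun o : Oracle => o (qs.getLastD [])) o₀ :=
        (continuous_apply _).continuousAt
      have := hc.eventually (show ∀ᶠ b in 𝓝 (o₀ (qs.getLastD [])), b = o₀ (qs.getLastD []) by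
        rw [nhds_discrete]; rfl)
      filter_upwards [this] with o ho
      rw [ho]) w (fun _ => false) t
  filter_upwards [this] with o ho
  have ho' : N.oracleRun o w t = N.oracleRun o₀ w t := ho
  rw [N.oracleOutput_eq ht, N.oracleOutput_eq (ho' ▸ ht), ho']

/-- `c'` agrees with `c`, except that the incoming tapes may differ beyond their first `k` bits. -/
def AgreeUpTo (M : Machine m) (k : ℕ) (c c' : M.Config) : Prop :=
  ∃ ib : Fin m → List Bool, c' = { c with inbox := ib } ∧
    ∀ i, (c.inbox i).take k = (ib i).take k

theorem AgreeUpTo.step {M : Machine m} {k : ℕ} {c c' : M.Config}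
    {env env' : Fin m → List (List Bool) → List Bool} (h : M.AgreeUpTo (k + 1) c c')
    (he : (M.step env c).sent = M.outgoing c →
      ∀ i, (env i (M.outgoing c i)).take k = (env' i (M.outgoing c i)).take k) :
    M.AgreeUpTo k (M.step env c) (M.step env' c') := by
  obtain ⟨ib, rfl, hib⟩ := h
  have hhead : (fun i => (ib i).head?) = fun i => (c.inbox i).head? := by
    funext i
    have := congrArg List.head? (hib i)
    simpa [List.head?_take] using this.symm
  have htail : ∀ i, ((c.inbox i).tail).take k = ((ib i).tail).take k := by
    intro i
    have := hib i
    cases h1 : c.inbox i <;> cases h2 : ib i <;> simp_all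
  have htake : ∀ i, (c.inbox i).take k = (ib i).take k := by
    intro i
    have := congrArg (List.take k) (hib i)
    simpa [List.take_take] using this
  by_cases hh : c.halted = true
  · rw [step_of_halted M env hh, step_of_halted M env' (by exact hh)]
    exact ⟨ib, rfl, htake⟩
  · simp only [Machine.step, hh, hhead] at he ⊢
    cases hs : (M.trans c.state (fun j => (c.tape j).head) (c.coins 0)
      (fun i => (c.inbox i).head?)).signal with
    | run =>
      refine ⟨_, rfl, fun i => ?_⟩
      simp only [Bool.false_eq_true, if_false]
      split_ifs
      · exact htail i
      · exact htake i
    | send =>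
      simp only [hs] at he
      exact ⟨_, rfl, fun i => he rfl i⟩
    | halt =>
      refine ⟨_, rfl, fun i => ?_⟩
      simp only [Bool.false_eq_true, if_false]
      split_ifs
      · exact htail i
      · exact htake i

theorem sent_step (M : Machine m) (env : Fin m → List (List Bool) → List Bool) (c : M.Config) :
    (M.step env c).sent = c.sent ∨ (M.step env c).sent = M.outgoing c := by
  by_cases hh : c.halted = true
  · exact Or.inl (by rw [step_of_halted M env hh])
  · simp only [step, hh, Bool.false_eq_true, if_false]
    cases hs : (M.trans c.state (fun j => (c.tape j).head) (c.coins 0)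
      (fun i => (c.inbox i).head?)).signal
    · exact Or.inl rfl
    · exact Or.inr rfl
    · exact Or.inl rfl

theorem sent_prefix (M : Machine m) (env : Fin m → List (List Bool) → List Bool) (x : List Bool)
    (ρ : ℕ → Bool) {t s : ℕ} (hts : t ≤ s) (i : Fin m) :
    (M.runFor env x ρ t).sent i <+: (M.runFor env x ρ s).sent i := by
  induction s, hts using Nat.le_induction with
  | base => exact List.prefix_rfl
  | succ s _ ih =>
    refine ih.trans ?_
    rw [runFor_succ]
    rcases M.sent_step env (M.runFor env x ρ s) with h | h
    · rw [h]
    · rw [h]; exact List.prefix_append _ _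

/-- In `t` steps the machine writes at most `t` messages of at most `t` bits on every channel. -/
theorem sent_bounds (M : Machine m) (env : Fin m → List (List Bool) → List Bool) (x : List Bool)
    (ρ : ℕ → Bool) (t : ℕ) (i : Fin m) :
    ((M.runFor env x ρ t).outbox i).length ≤ t ∧ ((M.runFor env x ρ t).sent i).length ≤ t ∧
      ∀ l ∈ (M.runFor env x ρ t).sent i, l.length ≤ t := by
  induction t with
  | zero => simp [runFor, init]
  | succ t ih =>
    obtain ⟨h1, h2, h3⟩ := ih
    rw [runFor_succ]
    generalize M.runFor env x ρ t = c at h1 h2 h3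
    have h3' : ∀ l ∈ c.sent i, l.length ≤ t + 1 := fun l hl => (h3 l hl).trans t.le_succ
    have hopt : ∀ b : Option Bool, b.toList.length ≤ 1 := fun b => by cases b <;> simp
    by_cases hh : c.halted = true
    · rw [step_of_halted M env hh]
      exact ⟨by omega, by omega, h3'⟩
    · simp only [step, hh, Bool.false_eq_true, if_false]
      have ho := hopt ((M.trans c.state (fun j => (c.tape j).head) (c.coins 0)
        (fun i => (c.inbox i).head?)).emit i)
      cases hs : (M.trans c.state (fun j => (c.tape j).head) (c.coins 0)
        (fun i => (c.inbox i).head?)).signal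
      · refine ⟨?_, by dsimp only; omega, h3'⟩
        simp only [List.length_append]; omega
      · refine ⟨by simp, ?_, ?_⟩
        · simp only [List.length_append, List.length_singleton]; omega
        · intro l hl
          simp only [List.mem_append, List.mem_singleton] at hl
          rcases hl with hl | rfl
          · exact h3' l hl
          · rw [List.length_append]; omega
      · refine ⟨?_, by dsimp only; omega, h3'⟩
        simp only [List.length_append]; omega

/-- The messages `ys` sent in the course of `T` steps, together with the first `T` bits of the
replies to their initial segments, determine the output. -/
theorem output_eq_of_replies_agree (M : Machine 1) {env env' : Fin 1 → List (List Bool) → List Bool}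
    {x : List Bool} {ρ : ℕ → Bool} {T : ℕ}
    (h : ∀ j < ((M.runFor env x ρ T).sent 0).length,
      (env 0 (((M.runFor env x ρ T).sent 0).take (j + 1))).take T =
        (env' 0 (((M.runFor env x ρ T).sent 0).take (j + 1))).take T) :
    (M.runFor env x ρ T).output = (M.runFor env' x ρ T).output := by
  have key : ∀ t ≤ T, M.AgreeUpTo (T - t) (M.runFor env x ρ t) (M.runFor env' x ρ t) := by
    intro t
    induction t with
    | zero => exact fun _ => ⟨_, rfl, fun _ => rfl⟩
    | succ t ih =>
      intro ht
      have h1 := ih (by omega)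
      rw [show T - t = (T - (t + 1)) + 1 by omega] at h1
      rw [runFor_succ, runFor_succ]
      refine h1.step fun hs i => ?_
      obtain rfl := Subsingleton.elim i 0
      have hp := M.sent_prefix env x ρ ht 0
      rw [runFor_succ, hs] at hp
      have hl : (M.outgoing (M.runFor env x ρ t) 0).length =
          ((M.runFor env x ρ t).sent 0).length + 1 := by simp [outgoing]
      have hle := hp.length_le
      have h2 := h ((M.runFor env x ρ t).sent 0).length (by omega)
      rw [← hl, ← List.prefix_iff_eq_take.1 hp] at h2
      have h3 := congrArg (List.take (T - (t + 1))) h2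
      simpa [List.take_take] using h3
  obtain ⟨ib, h1, -⟩ := key T le_rfl
  rw [h1]

instance (m : ℕ) : Countable (Machine m) := by
  have : Countable Signal := by
    have : Function.Injective (fun s : Signal => match s with
        | .run => (0 : ℕ) | .send => 1 | .halt => 2) := by
      intro a b; cases a <;> cases b <;> simp
    exact this.countable
  have : Countable Turing.Dir := by
    have : Function.Injective (fun d : Turing.Dir => decide (d = .left)) := by
      intro a b; cases a <;> cases b <;> simp
    exact this.countable
  have hI : ∀ s t, Countable (Instruction s t m) := by
    intro s t
    have : Function.Injective (fun a : Instruction s t m =>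
        (a.next, a.write, a.move, a.advanceCoin, a.advanceIn, a.emit, a.print, a.signal)) := by
      rintro ⟨⟩ ⟨⟩ h; simpa using h
    exact this.countable
  have (s t : ℕ) : Countable (Fin s × (Fin s → (Fin (t + 1) → Option Bool) → Bool →
      (Fin m → Option Bool) → Instruction s t m)) := by
    have := hI s t
    infer_instance
  have : Function.Injective (fun M : Machine m =>
      (⟨M.states, M.tapes, M.start, M.trans⟩ : Σ (s t : ℕ), Fin s × (Fin s →
        (Fin (t + 1) → Option Bool) → Bool → (Fin m → Option Bool) → Instruction s t m))) := by
    rintro ⟨s, t, a, b⟩ ⟨s', t', a', b'⟩ h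
    simp only [Sigma.mk.injEq] at h
    obtain ⟨rfl, h⟩ := h
    simp only [heq_eq_eq, Sigma.mk.injEq] at h
    obtain ⟨rfl, h⟩ := h
    simp only [heq_eq_eq, Prod.mk.injEq] at h
    obtain ⟨rfl, rfl⟩ := h
    rfl
  exact this.countable

end Machine

instance (ι : Type) : IsProbabilityMeasure (fairCoins ι) := by
  unfold fairCoins; infer_instance

instance : Countable (Polynomial ℕ) := by
  rw [← Cardinal.mk_le_aleph0_iff]
  exact Polynomial.cardinalMk_le_max.trans (by simp)

/-! ### One oracle does not suffice -/

/-- In a one-oracle scheme that leaks only the length, some content of the oracle tape and some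
sequence of messages are compatible with every input of length `n`. -/
theorem Protocol.exists_common_queries (S : Protocol 1) (h : S.LeaksAtMost List.length 0) (n : ℕ) :
    ∃ (ω : S.Ω) (ys : List (List Bool)), ∀ x : List Bool, x.length = n →
      ∃ ρ, S.queries 0 x ω ρ = ys := by
  classical
  let env : Oracle → Fin 1 → List (List Bool) → List Bool :=
    fun o i ys => (S.B i).oracleOutput o (encodeMessages ys)
  have hreply : ∀ ω, S.reply ω = env (S.O 0 ω) := by
    intro ω
    funext i ys
    obtain rfl := Subsingleton.elim i 0
    rfl
  let Q : Oracle → List Bool → (ℕ → Bool) → List (List Bool) :=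
    fun o x ρ => (S.A.runFor (env o) x ρ (S.time.eval x.length)).sent 0
  have hQ : ∀ x ω ρ, S.queries 0 x ω ρ = Q (S.O 0 ω) x ρ := by
    intro x ω ρ
    simp only [Protocol.queries, Protocol.final, hreply, Q]
  let W : List Bool → List (List Bool) → Set Oracle := fun x ys => {o | ∃ ρ, Q o x ρ = ys}
  -- Each possible content of the oracle tape that lies in `W x ys` lies in its interior, as the
  -- players halt on it. The interior, being open, is measurable.
  have hW : ∀ x ω ρ, S.O 0 ω ∈ interior (W x (Q (S.O 0 ω) x ρ)) := by
    intro x ω ρ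
    rw [mem_interior_iff_mem_nhds]
    have := S.A.eventually_runFor_eq env (S.O 0 ω) (fun i ys => by
      obtain rfl := Subsingleton.elim i 0
      exact (S.B 0).eventually_oracleOutput_eq (S.total 0 ω ys)) x ρ (S.time.eval x.length)
    filter_upwards [this] with o ho
    exact ⟨ρ, by simp only [Q, ho]⟩
  -- The inputs are drawn uniformly from the strings of length `n`, so each of them has positive
  -- probability.
  let s : Finset (List Bool) := (List.finite_length_eq Bool n).toFinset
  have hmem : ∀ x, x ∈ s ↔ x.length = n := fun x => by simp [s]
  let x₀ := List.replicate n false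
  have hx₀ : x₀ ∈ s := (hmem _).2 (by simp [x₀])
  have hs : s.Nonempty := ⟨x₀, hx₀⟩
  let X : Measure (List Bool) := (PMF.uniformOfFinset s hs).toMeasure
  have hX : ∀ x ∈ s, X {x} ≠ 0 := by
    intro x hx
    simp [X, PMF.toMeasure_apply_singleton, hx]
  let ν := S.P.prod (fairCoins ℕ)
  have hind := h X n ⟨x₀, by simp [x₀]⟩
  rw [indepFun_iff_measure_inter_preimage_eq_mul] at hind
  have hL : MeasurableSet {e : List Bool × S.Ω × (ℕ → Bool) | e.1.length = n} :=
    measurable_fst (MeasurableSet.of_discrete (s := {x : List Bool | x.length = n}))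
  -- On input `x`, the messages are never `ys` with a tape outside of `interior (W x ys)`. By
  -- independence this has probability zero on input `x₀`, too.
  have key : ∀ x ∈ s, ∀ ys,
      ν {e | Q (S.O 0 e.1) x₀ e.2 = ys ∧ S.O 0 e.1 ∉ interior (W x ys)} = 0 := by
    intro x hx ys
    have h1 := hind {x} ({ys} ×ˢ (interior (W x ys))ᶜ) (MeasurableSet.singleton x)
      ((MeasurableSet.singleton ys).prod isOpen_interior.measurableSet.compl)
    have h2 : (fun e : List Bool × S.Ω × (ℕ → Bool) => e.1) ⁻¹' {x} ∩
        (fun e : List Bool × S.Ω × (ℕ → Bool) => (S.queries 0 e.1 e.2.1 e.2.2, S.O 0 e.2.1)) ⁻¹'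
          ({ys} ×ˢ (interior (W x ys))ᶜ) = ∅ := by
      ext ⟨x', ω, ρ⟩
      simp only [Set.mem_inter_iff, Set.mem_preimage, Set.mem_singleton_iff, Set.mem_prod,
        Set.mem_compl_iff, Set.mem_empty_iff_false, iff_false, not_and, not_not, hQ]
      rintro rfl rfl
      exact hW x' ω ρ
    rw [h2, measure_empty, eq_comm, mul_eq_zero, cond_apply hL, cond_apply hL] at h1
    have h3 : ((X.prod ν) {e | e.1.length = n})⁻¹ ≠ 0 :=
      ENNReal.inv_ne_zero.2 (measure_ne_top _ _)
    have h4 : (X.prod ν) ({e | e.1.length = n} ∩ (fun e => e.1) ⁻¹' {x}) ≠ 0 := by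
      have : ({e | e.1.length = n} ∩ (fun e => e.1) ⁻¹' {x} : Set (List Bool × S.Ω × (ℕ → Bool)))
          = {x} ×ˢ Set.univ := by
        ext e
        simp only [Set.mem_inter_iff, Set.mem_ofPred_eq, Set.mem_preimage, Set.mem_singleton_iff,
          Set.mem_prod, Set.mem_univ, and_true, and_iff_right_iff_imp]
        rintro rfl
        exact (hmem _).1 hx
      rw [this, Measure.prod_prod]
      simpa using hX x hx
    have h5 := (mul_eq_zero.1 (h1.resolve_left (mul_ne_zero h3 h4))).resolve_left h3
    have h6 : X {x₀} * ν {e | Q (S.O 0 e.1) x₀ e.2 = ys ∧ S.O 0 e.1 ∉ interior (W x ys)} = 0 := by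
      rw [← Measure.prod_prod]
      refine measure_mono_null ?_ h5
      rintro ⟨x', ω, ρ⟩ ⟨h7, h8, h9⟩
      obtain rfl : x' = x₀ := h7
      exact ⟨(hmem _).1 hx₀, by simpa [hQ] using h8, h9⟩
    exact (mul_eq_zero.1 h6).resolve_left (hX x₀ hx₀)
  have hae : ∀ᵐ e ∂ν, ∀ x : List Bool, ∀ ys, x ∈ s →
      ¬ (Q (S.O 0 e.1) x₀ e.2 = ys ∧ S.O 0 e.1 ∉ interior (W x ys)) := by
    rw [ae_all_iff]; intro x
    rw [ae_all_iff]; intro ys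
    by_cases hx : x ∈ s
    · simp only [hx, true_imp_iff]
      rw [ae_iff]
      simpa only [not_not] using key x hx ys
    · simp [hx]
  obtain ⟨⟨ω, ρ⟩, he⟩ := hae.exists
  refine ⟨ω, Q (S.O 0 ω) x₀ ρ, fun x hx => ?_⟩
  have h1 := he x (Q (S.O 0 ω) x₀ ρ) ((hmem x).2 hx)
  simp only [true_and, not_not] at h1
  obtain ⟨ρ', h2⟩ := interior_subset h1
  exact ⟨ρ', by rw [hQ]; exact h2⟩

/-! ### Counting advice -/

/-- The information that determines a function on the inputs of a given length: `T` messages and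
the replies to them, both cut off after `T` bits. -/
abbrev Advice (T : ℕ) : Type := Fin T → Option (Fin T → Option Bool) × (Fin T → Option Bool)

theorem card_advice_le (T : ℕ) : Fintype.card (Advice T) ≤ 2 ^ (4 * T ^ 2) := by
  have hc : Fintype.card (Advice T) = ((3 ^ T + 1) * 3 ^ T) ^ T := by
    simp [Fintype.card_option]
  rw [hc]
  rcases T.eq_zero_or_pos with rfl | hT
  · simp
  · have h1 : 3 ^ T + 1 ≤ 4 ^ T := Nat.pow_lt_pow_left (by norm_num) hT.ne'
    calc ((3 ^ T + 1) * 3 ^ T) ^ T ≤ (4 ^ T * 4 ^ T) ^ T :=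
          Nat.pow_le_pow_left (Nat.mul_le_mul h1 (by omega)) T
      _ = 2 ^ (4 * T ^ 2) := by
          rw [← pow_add, ← pow_mul, show (4 : ℕ) = 2 ^ 2 by norm_num, ← pow_mul]
          congr 1; ring

theorem List.take_eq_of_getElem?_eq {α : Type*} {l l' : List α} {T : ℕ}
    (h : ∀ k : Fin T, l[(k : ℕ)]? = l'[(k : ℕ)]?) : l.take T = l'.take T := by
  refine List.ext_getElem? fun k => ?_
  rw [List.getElem?_take, List.getElem?_take]
  split_ifs with hk
  · exact h ⟨k, hk⟩
  · rfl

/-- Functions with schemes that have the same querier are described by advice: each of them has one,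
and a common advice forces two of them to agree on all strings of length `n`. -/
theorem exists_advice (A : Machine 1) (p : Polynomial ℕ) (n : ℕ) :
    ∃ R : (List Bool → Bool) → Advice (p.eval n) → Prop,
      (∀ f, (∃ S : Protocol 1, S.A = A ∧ S.time = p ∧ S.Computes (fun x => [f x]) ∧
        S.LeaksAtMost List.length 0) → ∃ κ, R f κ) ∧
      ∀ f f' κ, R f κ → R f' κ → ∀ x : List Bool, x.length = n → f x = f' x := by
  set T := p.eval n with hT
  refine ⟨fun f κ => ∃ (env : Fin 1 → List (List Bool) → List Bool) (ys : List (List Bool)),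
    (∀ x : List Bool, x.length = n → ∃ ρ, (A.runFor env x ρ T).sent 0 = ys) ∧
    (∀ x : List Bool, x.length = n → ∀ ρ, (A.runFor env x ρ T).output = [f x]) ∧
    κ = fun j : Fin T => (ys[(j : ℕ)]?.map fun l (k : Fin T) => l[(k : ℕ)]?,
      fun k : Fin T => (env 0 (ys.take (j + 1)))[(k : ℕ)]?), ?_, ?_⟩
  · rintro f ⟨S, rfl, rfl, hc, hl⟩
    obtain ⟨ω, ys, h⟩ := S.exists_common_queries hl n
    refine ⟨_, S.reply ω, ys, ?_, ?_, rfl⟩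
    · intro x hx
      obtain ⟨ρ, hρ⟩ := h x hx
      refine ⟨ρ, ?_⟩
      rw [← hρ, Protocol.queries, Protocol.final, hx]
    · intro x hx ρ
      have := hc x ω ρ
      rwa [Protocol.final, hx] at this
  · rintro f f' κ ⟨env, ys, h1, h2, rfl⟩ ⟨env', ys', h1', h2', hκ⟩ x hx
    obtain ⟨ρ, hρ⟩ := h1 x hx
    obtain ⟨ρ', hρ'⟩ := h1' x hx
    have hb := A.sent_bounds env x ρ T 0
    have hb' := A.sent_bounds env' x ρ' T 0
    rw [hρ] at hb
    rw [hρ'] at hb'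
    have hκ1 : ∀ j : Fin T, (ys[(j : ℕ)]?.map fun l (k : Fin T) => l[(k : ℕ)]?) =
        (ys'[(j : ℕ)]?.map fun l (k : Fin T) => l[(k : ℕ)]?) := fun j => congrArg Prod.fst (congrFun hκ j)
    have hκ2 : ∀ (j : Fin T) (k : Fin T), (env 0 (ys.take (j + 1)))[(k : ℕ)]? =
        (env' 0 (ys'.take (j + 1)))[(k : ℕ)]? :=
      fun j k => congrFun (congrArg Prod.snd (congrFun hκ j)) k
    have hys : ys = ys' := by
      refine List.ext_getElem? fun j => ?_
      by_cases hj : j < T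
      · have := hκ1 ⟨j, hj⟩
        cases hy : ys[j]? with
        | none => rw [hy] at this; simpa [eq_comm] using this
        | some l =>
          cases hy' : ys'[j]? with
          | none => rw [hy, hy'] at this; simp at this
          | some l' =>
            rw [hy, hy'] at this
            simp only [Option.map_some, Option.some.injEq] at this
            have h3 := hb.2.2 l (List.mem_of_getElem? hy)
            have h3' := hb'.2.2 l' (List.mem_of_getElem? hy')
            have h4 := List.take_eq_of_getElem?_eq fun k => congrFun this k
            rw [List.take_of_length_le h3, List.take_of_length_le h3'] at h4
            rw [h4]
      · rw [List.getElem?_eq_none (by omega), List.getElem?_eq_none (by omega)]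
    subst hys
    have hout := A.output_eq_of_replies_agree (env := env) (env' := env') (x := x) (ρ := ρ) (T := T)
      (by
        rw [hρ]
        intro j hj
        exact List.take_eq_of_getElem?_eq (hκ2 ⟨j, by omega⟩))
    rw [h2 x hx, h2' x hx] at hout
    simpa using hout

theorem fairCoins_cylinder {ι : Type} (s : Finset ι) (g : ι → Bool) :
    fairCoins ι {f | ∀ i ∈ s, f i = g i} = 2⁻¹ ^ s.card := by
  have : {f : ι → Bool | ∀ i ∈ s, f i = g i} = Set.pi s fun i => {g i} := by
    ext f; simp [Set.mem_pi]
  rw [this, fairCoins, Measure.infinitePi_pi _ fun i _ => MeasurableSet.singleton _]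
  simp

theorem Polynomial.exists_eval_le_pow (p : Polynomial ℕ) : ∃ k, ∀ n, p.eval n ≤ (n + 2) ^ k := by
  induction p using Polynomial.induction_on' with
  | add p q hp hq =>
    obtain ⟨k, hk⟩ := hp
    obtain ⟨l, hl⟩ := hq
    refine ⟨max k l + 1, fun n => ?_⟩
    rw [Polynomial.eval_add]
    have h1 := (hk n).trans (Nat.pow_le_pow_right (by omega) (le_max_left k l))
    have h2 := (hl n).trans (Nat.pow_le_pow_right (by omega) (le_max_right k l))
    rw [pow_succ]
    nlinarith [Nat.zero_le ((n + 2) ^ max k l * n)]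
  | monomial i a =>
    refine ⟨a + i, fun n => ?_⟩
    rw [Polynomial.eval_monomial, pow_add]
    refine Nat.mul_le_mul ?_ (Nat.pow_le_pow_left (by omega) i)
    exact Nat.lt_two_pow_self.le.trans (Nat.pow_le_pow_left (by omega) a)

theorem Polynomial.eventually_eval_le_two_pow (p : Polynomial ℕ) :
    ∀ᶠ n in Filter.atTop, p.eval n ≤ 2 ^ n := by
  obtain ⟨k, hk⟩ := p.exists_eval_le_pow
  have h1 := tendsto_pow_const_div_const_pow_of_one_lt k (r := 2) (by norm_num)
  have h2 := (Filter.tendsto_add_atTop_iff_nat 2).2 h1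
  filter_upwards [h2.eventually (gt_mem_nhds (show (0 : ℝ) < 1 / 4 by norm_num))] with n hn
  refine (hk n).trans ?_
  rw [div_lt_iff₀ (by positivity)] at hn
  have h3 : (((n + 2) ^ k : ℕ) : ℝ) ≤ ((2 ^ n : ℕ) : ℝ) := by
    push_cast at hn ⊢
    rw [pow_add] at hn
    linarith
  exact_mod_cast h3

/-- Advice of polynomial length determines a null set of functions: on strings of length `n` only
`2 ^ poly n` of the `2 ^ 2 ^ n` functions are described by it. -/
theorem fairCoins_eq_zero_of_advice (p : Polynomial ℕ) (F : Set (List Bool → Bool))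
    (h : ∀ n, ∃ R : (List Bool → Bool) → Advice (p.eval n) → Prop, (∀ f ∈ F, ∃ κ, R f κ) ∧
      ∀ f f' κ, R f κ → R f' κ → ∀ x : List Bool, x.length = n → f x = f' x) :
    fairCoins (List Bool) F = 0 := by
  classical
  have hle : ∀ n, fairCoins (List Bool) F ≤ 2 ^ (4 * p.eval n ^ 2) * 2⁻¹ ^ 2 ^ n := by
    intro n
    obtain ⟨R, hR1, hR2⟩ := h n
    let s : Finset (List Bool) := (List.finite_length_eq Bool n).toFinset
    have hmem : ∀ x, x ∈ s ↔ x.length = n := fun x => by simp [s]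
    have hcard : s.card = 2 ^ n := by
      have h1 : Nat.card {l : List Bool | l.length = n} = 2 ^ n := by
        have := card_vector (α := Bool) n
        rw [Fintype.card_bool] at this
        rw [← this, ← Nat.card_eq_fintype_card]
        rfl
      rw [← h1, Nat.card_coe_set_eq, Set.ncard_eq_toFinset_card _ (List.finite_length_eq Bool n)]
    have hC : ∀ κ, fairCoins (List Bool) {f | R f κ} ≤ 2⁻¹ ^ 2 ^ n := by
      intro κ
      by_cases hf : ∃ g, R g κ
      · obtain ⟨g, hg⟩ := hf
        rw [← hcard, ← fairCoins_cylinder s g]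
        exact measure_mono fun f hf x hx => hR2 f g κ hf hg x ((hmem x).1 hx)
      · have : {f | R f κ} = ∅ := by
          ext f; simp only [Set.mem_ofPred_eq, Set.mem_empty_iff_false, iff_false]
          exact fun hf' => hf ⟨f, hf'⟩
        simp [this]
    calc fairCoins (List Bool) F ≤ fairCoins (List Bool) (⋃ κ, {f | R f κ}) :=
          measure_mono fun f hf => by simpa using hR1 f hf
      _ ≤ ∑ κ, fairCoins (List Bool) {f | R f κ} := measure_iUnion_fintype_le _ _
      _ ≤ ∑ _κ : Advice (p.eval n), 2⁻¹ ^ 2 ^ n := Finset.sum_le_sum fun κ _ => hC κ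
      _ = Fintype.card (Advice (p.eval n)) * 2⁻¹ ^ 2 ^ n := by
          rw [Finset.sum_const, nsmul_eq_mul, Finset.card_univ]
      _ ≤ 2 ^ (4 * p.eval n ^ 2) * 2⁻¹ ^ 2 ^ n := by
          gcongr
          exact_mod_cast card_advice_le _
  have hle' : ∀ᶠ n in Filter.atTop, fairCoins (List Bool) F ≤ (2⁻¹ : ℝ≥0∞) ^ n := by
    filter_upwards [(4 * p ^ 2 + Polynomial.X).eventually_eval_le_two_pow] with n hn
    simp only [Polynomial.eval_add, Polynomial.eval_mul, Polynomial.eval_pow, Polynomial.eval_X,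
      Polynomial.eval_ofNat] at hn
    refine (hle n).trans ?_
    obtain ⟨d, hd⟩ := Nat.exists_eq_add_of_le hn
    rw [hd, pow_add, pow_add, ← mul_assoc, ← mul_assoc, ← mul_pow,
      ENNReal.mul_inv_cancel (by norm_num) (by norm_num), one_pow, one_mul]
    exact mul_le_of_le_one_right zero_le (pow_le_one₀ zero_le (by norm_num))
  have hlim : Filter.Tendsto (fun n => (2⁻¹ : ℝ≥0∞) ^ n) Filter.atTop (𝓝 0) :=
    ENNReal.tendsto_pow_atTop_nhds_zero_of_lt_one (by norm_num)
  exact le_antisymm (ge_of_tendsto hlim hle') zero_le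

theorem ae_not_hasInstanceHidingScheme_one :
    ∀ᵐ f : List Bool → Bool ∂(fairCoins (List Bool)),
      ¬ HasInstanceHidingScheme 1 (fun x => [f x]) := by
  let F : Machine 1 × Polynomial ℕ → Set (List Bool → Bool) := fun a =>
    {f | ∃ S : Protocol 1, S.A = a.1 ∧ S.time = a.2 ∧ S.Computes (fun x => [f x]) ∧
        S.LeaksAtMost List.length 0}
  have h : fairCoins (List Bool) (⋃ a, F a) = 0 :=
    measure_iUnion_null fun a => fairCoins_eq_zero_of_advice a.2 _ fun n =>
      exists_advice a.1 a.2 n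
  rw [ae_iff]
  refine measure_mono_null ?_ h
  intro f hf
  simp only [not_not, Set.mem_ofPred_eq] at hf
  obtain ⟨S, h1, h2⟩ := hf
  exact Set.mem_iUnion.2 ⟨(S.A, S.time), S, rfl, rfl, h1, h2 0⟩

/-! ### Single steps -/

/-- The effect of an instruction on work tape number `j`. -/
def Instruction.actOn {s t m : ℕ} (a : Instruction s t m) (j : Fin (t + 1))
    (T : Turing.Tape (Option Bool)) : Turing.Tape (Option Bool) :=
  match a.move j with
  | none => T.write (a.write j)
  | some d => (T.write (a.write j)).move d

namespace Machine

variable {m : ℕ}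

/-- The instruction that is executed in the configuration `c`. -/
def instr (M : Machine m) (c : M.Config) : Instruction M.states M.tapes m :=
  M.trans c.state (fun j => (c.tape j).head) (c.coins 0) fun i => (c.inbox i).head?

theorem step_run (M : Machine m) (env : Fin m → List (List Bool) → List Bool) {c : M.Config}
    (hc : c.halted = false) (hs : (M.instr c).signal = .run) :
    M.step env c = ⟨(M.instr c).next, fun j => (M.instr c).actOn j (c.tape j),
      if (M.instr c).advanceCoin then fun k => c.coins (k + 1) else c.coins,
      fun i => if (M.instr c).advanceIn i then (c.inbox i).tail else c.inbox i,
      fun i => c.outbox i ++ ((M.instr c).emit i).toList, c.sent,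
      c.output ++ (M.instr c).print.toList, false⟩ := by
  unfold instr at *
  simp only [step, hc, hs, Bool.false_eq_true, if_false]
  rfl

theorem step_send (M : Machine m) (env : Fin m → List (List Bool) → List Bool) {c : M.Config}
    (hc : c.halted = false) (hs : (M.instr c).signal = .send) :
    M.step env c = ⟨(M.instr c).next, fun j => (M.instr c).actOn j (c.tape j),
      if (M.instr c).advanceCoin then fun k => c.coins (k + 1) else c.coins,
      fun i => env i (c.sent i ++ [c.outbox i ++ ((M.instr c).emit i).toList]), fun _ => [],
      fun i => c.sent i ++ [c.outbox i ++ ((M.instr c).emit i).toList],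
      c.output ++ (M.instr c).print.toList, false⟩ := by
  unfold instr at *
  simp only [step, hc, hs, Bool.false_eq_true, if_false]
  rfl

theorem step_halt (M : Machine m) (env : Fin m → List (List Bool) → List Bool) {c : M.Config}
    (hc : c.halted = false) (hs : (M.instr c).signal = .halt) :
    M.step env c = ⟨(M.instr c).next, fun j => (M.instr c).actOn j (c.tape j),
      if (M.instr c).advanceCoin then fun k => c.coins (k + 1) else c.coins,
      fun i => if (M.instr c).advanceIn i then (c.inbox i).tail else c.inbox i,
      fun i => c.outbox i ++ ((M.instr c).emit i).toList, c.sent,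
      c.output ++ (M.instr c).print.toList, true⟩ := by
  unfold instr at *
  simp only [step, hc, hs, Bool.false_eq_true, if_false]
  rfl

end Machine

theorem Turing.Tape.head_eq_nth_zero {Γ : Type*} [Inhabited Γ] (T : Turing.Tape Γ) :
    T.head = T.nth 0 := rfl

/-- The symbols of the input tape: beyond the end of the input it is blank. -/
theorem Turing.Tape.mk₁_map_some_nth (w : List Bool) (i : ℕ) :
    (Turing.Tape.mk₁ (w.map some)).nth i = w[i]? := by
  rw [Turing.Tape.mk₁, Turing.Tape.mk₂, Turing.Tape.mk'_nth_nat, Turing.ListBlank.nth_mk,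
    ← List.getD_default_eq_getI, List.getD_eq_getElem?_getD, List.getElem?_map]
  cases w[i]? <;> rfl

/-! ### The players -/

/-- The oracle machine that asks its oracle about its own input and outputs the answer. -/
def askInput : Machine 1 where
  states := 2
  tapes := 0
  start := 0
  trans q scanned _ inbox :=
    if q = 0 then
      { next := if (scanned 0).isSome then 0 else 1
        write := scanned
        move := fun _ => some .right
        advanceCoin := false
        advanceIn := fun _ => false
        emit := fun _ => scanned 0
        print := none
        signal := if (scanned 0).isSome then .run else .send }
    else
      { next := 1
        write := scanned
        move := fun _ => none
        advanceCoin := false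
        advanceIn := fun _ => false
        emit := fun _ => none
        print := inbox 0
        signal := .halt }

/-- After `t ≤ |w|` steps, `t` bits of the input have been copied to the query tape. -/
theorem askInput_copying (o : Oracle) (w : List Bool) (t : ℕ) (ht : t ≤ w.length) :
    let c := askInput.oracleRun o w t
    c.state = (0 : Fin 2) ∧ c.halted = false ∧ c.outbox = (fun _ => w.take t) ∧
      c.sent = (fun _ => []) ∧ c.output = [] ∧
      ∀ i : ℕ, (c.tape (0 : Fin 1)).nth i = w[t + i]? := by
  induction t with
  | zero =>
    refine ⟨rfl, rfl, by simp [Machine.oracleRun, Machine.runFor, Machine.init], rfl, rfl,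
      fun i => ?_⟩
    rw [Nat.zero_add]
    exact Turing.Tape.mk₁_map_some_nth w i
  | succ t ih =>
    obtain ⟨h1, h2, h3, h4, h5, h6⟩ := ih (by omega)
    intro c'
    have hc' : c' = askInput.step _ (askInput.oracleRun o w t) := askInput.runFor_succ _ _ _ _
    generalize askInput.oracleRun o w t = c at *
    have hw : (c.tape (0 : Fin 1)).head = some w[t] := by
      rw [Turing.Tape.head_eq_nth_zero]
      have := h6 0
      rwa [Nat.cast_zero, Nat.add_zero, List.getElem?_eq_getElem (by omega)] at this
    have hi : askInput.instr c = ⟨(0 : Fin 2), fun j => (c.tape j).head, fun _ => some .right,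
        false, fun _ => false, fun _ => some w[t], none, .run⟩ := by
      simp [Machine.instr, askInput, h1, hw]
    rw [askInput.step_run _ h2 (by rw [hi]), hi] at hc'
    rw [hc']
    refine ⟨rfl, rfl, ?_, h4, by simp [h5], fun i => ?_⟩
    · funext i
      simp [h3]
    · simp only [Instruction.actOn, Turing.Tape.write_self, Turing.Tape.move_right_nth]
      have := h6 (i + 1)
      push_cast at this
      rw [this]
      congr 1
      omega

theorem askInput_run (o : Oracle) (w : List Bool) :
    (askInput.oracleRun o w (w.length + 2)).halted = true ∧
      (askInput.oracleRun o w (w.length + 2)).output = [o w] := by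
  obtain ⟨h1, h2, h3, h4, h5, h6⟩ := askInput_copying o w w.length le_rfl
  have e1 : askInput.oracleRun o w (w.length + 1) =
      askInput.step _ (askInput.oracleRun o w w.length) := askInput.runFor_succ _ _ _ _
  have e2 : askInput.oracleRun o w (w.length + 2) =
      askInput.step _ (askInput.oracleRun o w (w.length + 1)) := askInput.runFor_succ _ _ _ _
  generalize askInput.oracleRun o w w.length = c at *
  generalize askInput.oracleRun o w (w.length + 1) = c' at *
  have hw : (c.tape (0 : Fin 1)).head = none := by
    rw [Turing.Tape.head_eq_nth_zero]
    simpa using h6 0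
  have hi : askInput.instr c = ⟨(1 : Fin 2), fun j => (c.tape j).head, fun _ => some .right,
      false, fun _ => false, fun _ => none, none, .send⟩ := by
    simp [Machine.instr, askInput, h1, hw]
  rw [askInput.step_send _ h2 (by rw [hi]), hi] at e1
  have hi' : askInput.instr c' = ⟨(1 : Fin 2), fun j => (c'.tape j).head, fun _ => none,
      false, fun _ => false, fun _ => none, some (o w), .halt⟩ := by
    subst e1
    simp [Machine.instr, askInput, h3, h4]
  rw [askInput.step_halt _ (by rw [e1]) (by rw [hi']), hi'] at e2
  rw [e2, e1]
  exact ⟨rfl, by simp [h5]⟩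

theorem askInput_halts (o : Oracle) (w : List Bool) : askInput.OracleHalts o w :=
  ⟨_, (askInput_run o w).1⟩

theorem askInput_output (o : Oracle) (w : List Bool) : askInput.oracleOutput o w = [o w] := by
  rw [askInput.oracleOutput_eq (askInput_run o w).1, (askInput_run o w).2]

/-! ### The clock -/

/-- The decrement of the number with digits `D` in base `n + 2` (least significant digit first). -/
def decDigits (n : ℕ) {k : ℕ} (D : Fin k → ℕ) (i : Fin k) : ℕ :=
  if ∀ j < i, D j = 0 then (if D i = 0 then n + 1 else D i - 1) else D i

/-- The number with digits `D` in base `n + 2`. -/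
def digitsValue (n : ℕ) {k : ℕ} (D : Fin k → ℕ) : ℕ := ∑ i, D i * (n + 2) ^ (i : ℕ)

theorem digitsValue_succ (n : ℕ) {k : ℕ} (D : Fin (k + 1) → ℕ) :
    digitsValue n D = D 0 + (n + 2) * digitsValue n (fun i => D i.succ) := by
  simp only [digitsValue, Fin.sum_univ_succ, Fin.val_zero, pow_zero, mul_one, Fin.val_succ,
    Finset.mul_sum, pow_succ]
  congr 1
  exact Finset.sum_congr rfl fun i _ => by ring

theorem digitsValue_decDigits (n : ℕ) {k : ℕ} (D : Fin k → ℕ) (h : ¬ ∀ i, D i = 0) :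
    digitsValue n (decDigits n D) + 1 = digitsValue n D := by
  induction k with
  | zero => exact absurd (fun i => i.elim0) h
  | succ k ih =>
    have h0 : decDigits n D 0 = if D 0 = 0 then n + 1 else D 0 - 1 := by
      simp [decDigits]
    rw [digitsValue_succ, digitsValue_succ, h0]
    by_cases hD : D 0 = 0
    · have h1 : (fun i : Fin k => decDigits n D i.succ) = decDigits n fun i => D i.succ := by
        funext i
        simp [decDigits, Fin.forall_fin_succ, hD]
      have h2 : ¬ ∀ i : Fin k, D i.succ = 0 := fun h2 =>
        h (Fin.forall_fin_succ.2 ⟨hD, h2⟩)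
      rw [h1, if_pos hD, hD, ← ih _ h2]
      ring
    · have h1 : (fun i : Fin k => decDigits n D i.succ) = fun i => D i.succ := by
        funext i
        simp [decDigits, Fin.forall_fin_succ, hD]
      rw [h1, if_neg hD]
      omega

theorem digitsValue_max (n k : ℕ) : digitsValue n (fun _ : Fin k => n + 1) + 1 = (n + 2) ^ k := by
  induction k with
  | zero => simp [digitsValue]
  | succ k ih =>
    rw [digitsValue_succ, pow_succ, ← ih]
    ring

theorem digitsValue_eq_zero {n k : ℕ} {D : Fin k → ℕ} : digitsValue n D = 0 ↔ ∀ i, D i = 0 := by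
  simp [digitsValue]

/-- The content of a clock tape: `1 0ⁿ` from cell `0` on, and blanks elsewhere. Both ends of the
range `0, …, n + 1` of cells are thereby marked. -/
def clockContent (n : ℕ) (a : ℤ) : Option Bool :=
  if a = 0 then some true else if 0 < a ∧ a ≤ n then some false else none

/-- `T` has the content of a clock tape, and its head is at cell `pos`. -/
def IsClock (n : ℕ) (pos : ℤ) (T : Turing.Tape (Option Bool)) : Prop :=
  ∀ a : ℤ, T.nth (a - pos) = clockContent n a

theorem IsClock.head {n : ℕ} {pos : ℤ} {T : Turing.Tape (Option Bool)} (h : IsClock n pos T) :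
    T.head = clockContent n pos := by
  rw [Turing.Tape.head_eq_nth_zero, ← h pos, sub_self]

theorem IsClock.move_left {n : ℕ} {pos : ℤ} {T : Turing.Tape (Option Bool)} (h : IsClock n pos T) :
    IsClock n (pos - 1) (T.move .left) := by
  intro a
  rw [Turing.Tape.move_left_nth, ← h a]
  congr 1; ring

theorem IsClock.move_right {n : ℕ} {pos : ℤ} {T : Turing.Tape (Option Bool)} (h : IsClock n pos T) :
    IsClock n (pos + 1) (T.move .right) := by
  intro a
  rw [Turing.Tape.move_right_nth, ← h a]
  congr 1; ring

theorem isClock_zero : IsClock 0 1 (((Turing.Tape.mk₁ []).write (some true)).move .right) := by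
  intro a
  have hb : ∀ i : ℤ, (Turing.Tape.mk₁ ([] : List (Option Bool))).nth i = none := by
    intro i
    rcases i with i | i
    · have := Turing.Tape.mk₁_map_some_nth [] i
      simpa using this
    · change (Turing.ListBlank.mk []).nth i = none
      rw [Turing.ListBlank.nth_mk, List.getI_nil]; rfl
  rw [Turing.Tape.move_right_nth, Turing.Tape.write_nth, hb, clockContent]
  have h2 : ¬ (0 < a ∧ a ≤ ((0 : ℕ) : ℤ)) := by push_cast; omega
  by_cases ha : a = 0
  · simp [ha]
  · rw [if_neg (by omega), if_neg ha, if_neg h2]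

theorem IsClock.extend {n : ℕ} {T : Turing.Tape (Option Bool)} (h : IsClock n (n + 1) T) :
    IsClock (n + 1) ((n + 1 : ℕ) + 1) ((T.write (some false)).move .right) := by
  intro a
  rw [Turing.Tape.move_right_nth, Turing.Tape.write_nth]
  have h1 := h a
  have e : a - ((n + 1 : ℕ) + 1) + 1 = a - (n + 1) := by push_cast; ring
  rw [e, h1, clockContent, clockContent]
  push_cast
  split_ifs <;> first | rfl | omega

/-- The cell of a clock head at distance `D` from the end, `0` or `n + 1`, towards which it moves.
It moves to the left if `d` holds. -/
def clockPos (n : ℕ) (d : Bool) (D : ℕ) : ℤ := if d then D else n + 1 - D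

/-- Whether the scanned symbol is the one at the end towards which the head is moving. -/
def atEnd (d : Bool) (s : Option Bool) : Bool := if d then s == some true else s == none

theorem atEnd_clockContent {n D : ℕ} (d : Bool) (hD : D ≤ n + 1) :
    atEnd d (clockContent n (clockPos n d D)) = true ↔ D = 0 := by
  cases d
  · simp only [atEnd, clockPos, clockContent, Bool.false_eq_true, if_false]
    split_ifs
    · simp; omega
    · simp; omega
    · simp; omega
  · simp only [atEnd, clockPos, clockContent, if_true]
    split_ifs
    · simp; omega
    · simp; omega
    · simp; omega

/-- One clock tape in one step of the clock, where `low` holds if all less significant digits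
are zero. -/
theorem IsClock.tick {s t m n D : ℕ} {d : Bool} {T : Turing.Tape (Option Bool)}
    (h : IsClock n (clockPos n d D) T) (low : Prop) [Decidable low] {a : Instruction s t m}
    {j : Fin (t + 1)} (hw : a.write j = T.head)
    (hm : a.move j = if low ∧ ¬ D = 0 then some (if d then .left else .right) else none) :
    IsClock n (clockPos n (if low ∧ D = 0 then !d else d)
      (if low then (if D = 0 then n + 1 else D - 1) else D)) (a.actOn j T) := by
  rw [Instruction.actOn, hw, hm, Turing.Tape.write_self]
  by_cases h1 : low
  · by_cases h2 : D = 0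
    · subst h2
      cases d <;> simpa [h1, clockPos] using h
    · have hc : ((D - 1 : ℕ) : ℤ) = D - 1 := by omega
      cases d
      · have := h.move_right
        simp only [h1, h2, clockPos, hc, and_false, not_false_eq_true, and_self, if_true, if_false,
          Bool.false_eq_true] at this ⊢
        convert this using 1
        ring
      · have := h.move_left
        simpa only [h1, h2, clockPos, hc, and_false, not_false_eq_true, and_self, if_true,
          if_false] using this
  · simpa [h1] using h

/-! ### The querier -/

/-- The states of the querier with `k` clock tapes: `start`, `read` while the input is read, and
`tick dir flag` afterwards. In the latter, the `i`-th clock head moves to the left iff `dir i`, and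
`flag` tells whether the next bit that is received belongs to the output. -/
inductive QuerierState (k : ℕ) where
  | start
  | read
  | tick (dir : Fin k → Bool) (flag : Bool)
deriving Fintype

/-- The number of a state of the querier. -/
noncomputable def QuerierState.code {k : ℕ} (q : QuerierState k) :
    Fin (Fintype.card (QuerierState k)) :=
  Fintype.equivFin _ q

/-- The querier. While reading the input, it sends on each channel the input bits, masked with the
bits received on the other channel. Thereafter it sends empty messages only, and xors the bits that
it receives on the two channels. In the resulting sequence, a bit `1` announces that the next bit
is to be printed, and other bits are ignored.

The `k` clock tapes bound the number of rounds: their heads run through all combinations of the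
`n + 2` positions, where a head changes its direction instead of returning to its origin. -/
noncomputable def querier (k : ℕ) : Machine 2 where
  states := Fintype.card (QuerierState k)
  tapes := k
  start := QuerierState.start.code
  trans q scanned _ inbox :=
    match (Fintype.equivFin _).symm q with
    | .start =>
      { next := QuerierState.read.code
        write := Fin.cons (scanned 0) fun _ => some true
        move := Fin.cons none fun _ => some .right
        advanceCoin := false
        advanceIn := fun _ => false
        emit := fun _ => none
        print := none
        signal := .send }
    | .read =>
      match scanned 0 with
      | some b =>
        { next := QuerierState.read.code
          write := Fin.cons (some b) fun _ => some false
          move := fun _ => some .right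
          advanceCoin := false
          advanceIn := fun _ => false
          emit := fun i => some (xor b ((inbox i.rev).getD false))
          print := none
          signal := .send }
      | none =>
        { next := (QuerierState.tick (fun _ => true) false).code
          write := scanned
          move := fun _ => none
          advanceCoin := false
          advanceIn := fun _ => false
          emit := fun _ => none
          print := none
          signal := .send }
    | .tick dir flag =>
      let ended : Fin k → Bool := fun i => atEnd (dir i) (scanned i.succ)
      let bit := xor ((inbox 0).getD false) ((inbox 1).getD false)
      { next := (QuerierState.tick
          (fun i => if (∀ j < i, ended j = true) ∧ ended i = true then !dir i else dir i)
          (!flag && bit)).code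
        write := scanned
        move := Fin.cons none fun i => if (∀ j < i, ended j = true) ∧ ended i = false then
          some (if dir i then .left else .right) else none
        advanceCoin := false
        advanceIn := fun _ => false
        emit := fun _ => none
        print := if flag then some bit else none
        signal := if ∀ i, ended i = true then .halt else .send }

namespace querier

variable {k : ℕ}

/-- `j` bits of the input `x` have been read. -/
structure Reading (x : List Bool) (j : ℕ) (c : (querier k).Config) : Prop where
  state : c.state = QuerierState.read.code
  halted : c.halted = false
  outbox : c.outbox = fun _ => []
  input : ∀ i : ℕ, (c.tape (0 : Fin (k + 1))).nth i = x[j + i]?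
  clock : ∀ i : Fin k, IsClock j (j + 1) (c.tape i.succ)

/-- The clock shows the digits `D`, least significant digit first. -/
structure Ticking (n : ℕ) (D : Fin k → ℕ) (flag : Bool) (c : (querier k).Config) : Prop where
  state : ∃ dir, c.state = (QuerierState.tick dir flag).code ∧
    ∀ i, IsClock n (clockPos n (dir i) (D i)) (c.tape i.succ)
  halted : c.halted = false
  outbox : c.outbox = fun _ => []
  le : ∀ i, D i ≤ n + 1

/-- The first bit received on channel `i` in the last round (`false` if there is none). -/
def received (c : (querier k).Config) (i : Fin 2) : Bool := (c.inbox i).head?.getD false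

theorem init_step (env : Fin 2 → List (List Bool) → List Bool) (x : List Bool) (ρ : ℕ → Bool) :
    let c := (querier k).runFor env x ρ 1
    Reading x 0 c ∧ c.sent = (fun _ => [[]]) ∧ c.inbox = (fun i => env i [[]]) ∧
      c.output = [] := by
  intro c
  have hc : c = (querier k).step env ((querier k).init x ρ) := rfl
  have hi : (querier k).instr ((querier k).init x ρ) = ⟨QuerierState.read.code,
      Fin.cons ((((querier k).init x ρ).tape (0 : Fin (k + 1))).head) fun _ => some true,
      Fin.cons none fun _ => some .right, false, fun _ => false, fun _ => none, none, .send⟩ := by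
    simp [Machine.instr, querier, Machine.init, QuerierState.code]
  rw [Machine.step_send _ _ rfl (by rw [hi]), hi] at hc
  rw [hc]
  refine ⟨⟨rfl, rfl, rfl, fun i => ?_, fun i => ?_⟩, rfl, rfl, rfl⟩
  · change (((Turing.Tape.mk₁ (x.map some)).write (Turing.Tape.mk₁ (x.map some)).head)).nth i = _
    rw [Turing.Tape.write_self, Turing.Tape.mk₁_map_some_nth, Nat.zero_add]
  · exact isClock_zero

theorem Reading.step {x : List Bool} {j : ℕ} {c : (querier k).Config} (h : Reading x j c)
    (hj : j < x.length) (env : Fin 2 → List (List Bool) → List Bool) :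
    let c' := (querier k).step env c
    Reading x (j + 1) c' ∧
      c'.sent = (fun i => c.sent i ++ [[xor x[j] (received c i.rev)]]) ∧
      c'.inbox = (fun i => env i (c'.sent i)) ∧ c'.output = c.output := by
  intro c'
  have hw : (c.tape (0 : Fin (k + 1))).head = some x[j] := by
    rw [Turing.Tape.head_eq_nth_zero]
    exact (h.input 0).trans (by simp [hj])
  have hi : (querier k).instr c = ⟨QuerierState.read.code,
      Fin.cons ((c.tape (0 : Fin (k + 1))).head) fun _ => some false,
      fun _ => some .right, false, fun _ => false,
      fun i => some (xor x[j] (received c i.rev)), none, .send⟩ := by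
    simp [Machine.instr, querier, h.state, QuerierState.code, hw, received]
  have hc : c' = _ := Machine.step_send _ env h.halted (by rw [hi])
  rw [hi] at hc
  rw [hc]
  refine ⟨⟨rfl, rfl, rfl, fun i => ?_, fun i => ?_⟩, ?_, rfl, by simp⟩
  · change (((c.tape (0 : Fin (k + 1))).write (c.tape (0 : Fin (k + 1))).head).move .right).nth i
      = _
    rw [Turing.Tape.write_self, Turing.Tape.move_right_nth]
    have := h.input (i + 1)
    push_cast at this
    rw [this, show j + (i + 1) = j + 1 + i by omega]
  · exact (h.clock i).extend
  · simp [h.outbox]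

/-- At the end of the input the clock starts with all digits maximal. -/
theorem Reading.finish {x : List Bool} {c : (querier k).Config} (h : Reading x x.length c)
    (env : Fin 2 → List (List Bool) → List Bool) :
    let c' := (querier k).step env c
    Ticking x.length (fun _ => x.length + 1) false c' ∧
      c'.sent = (fun i => c.sent i ++ [[]]) ∧
      c'.inbox = (fun i => env i (c'.sent i)) ∧ c'.output = c.output := by
  intro c'
  have hw : (c.tape (0 : Fin (k + 1))).head = none := by
    rw [Turing.Tape.head_eq_nth_zero]
    simpa using h.input 0
  have hi : (querier k).instr c = ⟨(QuerierState.tick (fun _ => true) false).code,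
      fun j => (c.tape j).head, fun _ => none, false, fun _ => false,
      fun i => none, none, .send⟩ := by
    simp [Machine.instr, querier, h.state, QuerierState.code, hw]
  have hc : c' = _ := Machine.step_send _ env h.halted (by rw [hi])
  rw [hi] at hc
  rw [hc]
  refine ⟨⟨⟨_, rfl, fun i => ?_⟩, rfl, rfl, fun _ => le_rfl⟩, ?_, rfl, by simp⟩
  · simp only [Instruction.actOn, Turing.Tape.write_self]
    have := h.clock i
    simpa [clockPos] using this
  · simp [h.outbox]

theorem Ticking.step {n : ℕ} {D : Fin k → ℕ} {flag : Bool} {c : (querier k).Config}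
    (h : Ticking n D flag c) (env : Fin 2 → List (List Bool) → List Bool) :
    let c' := (querier k).step env c
    let bit := xor (received c 0) (received c 1)
    c'.output = c.output ++ (if flag then [bit] else []) ∧
      ((∀ i, D i = 0) → c'.halted = true ∧ c'.sent = c.sent) ∧
      ((¬ ∀ i, D i = 0) → Ticking n (decDigits n D) (!flag && bit) c' ∧
        c'.sent = (fun i => c.sent i ++ [[]]) ∧ c'.inbox = (fun i => env i (c'.sent i))) := by
  intro c' bit
  obtain ⟨dir, hstate, hclock⟩ := h.state
  have hended : ∀ i : Fin k, atEnd (dir i) (c.tape i.succ).head = true ↔ D i = 0 := by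
    intro i
    rw [(hclock i).head]
    exact atEnd_clockContent _ (h.le i)
  have hi : (querier k).instr c = ⟨(QuerierState.tick
        (fun i => if (∀ j < i, D j = 0) ∧ D i = 0 then !dir i else dir i) (!flag && bit)).code,
      fun j => (c.tape j).head,
      Fin.cons none fun i : Fin k => if (∀ j < i, D j = 0) ∧ ¬ D i = 0 then
          some (if dir i then .left else .right) else none,
      false, fun _ => false, fun _ => none, if flag then some bit else none,
      if ∀ i, D i = 0 then .halt else .send⟩ := by
    simp only [← hended]
    simp [Machine.instr, querier, hstate, QuerierState.code, bit, received]
  have hout : (if flag then some bit else none).toList = if flag then [bit] else [] := by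
    cases flag <;> rfl
  by_cases hD : ∀ i, D i = 0
  · have hc : c' = _ := Machine.step_halt _ env h.halted (by rw [hi]; exact if_pos hD)
    rw [hi] at hc
    rw [hc]
    exact ⟨by rw [← hout], fun _ => ⟨rfl, rfl⟩, fun h' => absurd hD h'⟩
  · have hc : c' = _ := Machine.step_send _ env h.halted (by rw [hi]; exact if_neg hD)
    rw [hi] at hc
    rw [hc]
    refine ⟨by rw [← hout], fun h' => absurd h' hD, fun _ => ⟨⟨⟨_, rfl, fun i => ?_⟩, rfl, rfl,
      fun i => ?_⟩, by simp [h.outbox], rfl⟩⟩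
    · exact (hclock i).tick (∀ j < i, D j = 0) rfl rfl
    · have := h.le i
      simp only [decDigits]
      split_ifs <;> omega

end querier

namespace querier

variable {k : ℕ}

theorem reading_runFor (env : Fin 2 → List (List Bool) → List Bool) (x : List Bool) (ρ : ℕ → Bool)
    {j : ℕ} (hj : j ≤ x.length) : Reading x j ((querier k).runFor env x ρ (j + 1)) := by
  induction j with
  | zero => exact (init_step env x ρ).1
  | succ j ih =>
    rw [Machine.runFor_succ]
    exact ((ih (by omega)).step (by omega) env).1

/-- The timing of the querier does not depend on the replies. -/
theorem ticking_runFor (env : Fin 2 → List (List Bool) → List Bool) (x : List Bool) (ρ : ℕ → Bool)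
    {t : ℕ} (ht : t < (x.length + 2) ^ k) :
    ∃ D flag, digitsValue x.length D + (t + 1) = (x.length + 2) ^ k ∧
      Ticking x.length D flag ((querier k).runFor env x ρ (x.length + 2 + t)) := by
  induction t with
  | zero =>
    refine ⟨_, false, digitsValue_max _ _, ?_⟩
    rw [Nat.add_zero, Machine.runFor_succ]
    exact ((reading_runFor env x ρ le_rfl).finish env).1
  | succ t ih =>
    obtain ⟨D, flag, hD, h⟩ := ih (by omega)
    have h0 : ¬ ∀ i, D i = 0 := fun h0 => by
      rw [digitsValue_eq_zero.2 h0] at hD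
      omega
    have h1 := ((h.step env).2.2 h0).1
    have h2 := digitsValue_decDigits x.length D h0
    rw [← Machine.runFor_succ] at h1
    exact ⟨_, _, by omega, h1⟩

theorem halted_runFor (env : Fin 2 → List (List Bool) → List Bool) (x : List Bool) (ρ : ℕ → Bool) :
    ((querier k).runFor env x ρ (x.length + 2 + (x.length + 2) ^ k)).halted = true := by
  have hpos : 0 < (x.length + 2) ^ k := by positivity
  obtain ⟨t, ht⟩ : ∃ t, (x.length + 2) ^ k = t + 1 := ⟨_, (Nat.succ_pred_eq_of_pos hpos).symm⟩
  obtain ⟨D, flag, hD, h⟩ := ticking_runFor (k := k) env x ρ (t := t) (by omega)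
  rw [ht, ← Nat.add_assoc, Machine.runFor_succ]
  exact ((h.step env).2.1 ((digitsValue_eq_zero (n := x.length)).1 (by omega))).1

end querier

/-! ### The run of the protocol -/

/-- The string `w`, xored bit by bit with the sequence `a`. -/
def mask (a : ℕ → Bool) (w : List Bool) : List Bool := w.mapIdx fun j b => xor b (a j)

@[simp] theorem length_mask (a : ℕ → Bool) (w : List Bool) : (mask a w).length = w.length := by
  simp [mask]

theorem mask_mask (a : ℕ → Bool) (w : List Bool) : mask a (mask a w) = w := by
  refine List.ext_getElem (by simp) fun i h1 h2 => ?_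
  simp [mask]

/-- The messages sent on a channel when `z` is the masked input, after `t` empty messages that
follow it. -/
def history (z : List Bool) (t : ℕ) : List (List Bool) :=
  [] :: (z.map (fun b => [b]) ++ List.replicate t [])

theorem history_succ (z : List Bool) (t : ℕ) : history z (t + 1) = history z t ++ [[]] := by
  simp [history, List.replicate_succ']

theorem history_concat (z : List Bool) (b : Bool) :
    history (z ++ [b]) 0 = history z 0 ++ [[b]] := by
  simp [history]

/-- A player whose tape describes the sequence `a` and the table `tbl` replies with the bits of `a`
while it receives bits, and then with the row of `tbl` that belongs to the received string. -/
def answer (a : ℕ → Bool) (tbl : List Bool → ℕ → Bool) (ys : List (List Bool)) : Bool :=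
  if ys.getLast? = some [] ∧ 2 ≤ ys.length then
    tbl ys.flatten (ys.length - ys.flatten.length - 2)
  else a (ys.length - 1)

theorem answer_history_zero (a : ℕ → Bool) (tbl : List Bool → ℕ → Bool) (z : List Bool) :
    answer a tbl (history z 0) = a z.length := by
  have : ¬ ((history z 0).getLast? = some [] ∧ 2 ≤ (history z 0).length) := by
    rcases List.eq_nil_or_concat' z with rfl | ⟨z, b, rfl⟩
    · simp [history]
    · rw [history_concat]
      simp
  rw [answer, if_neg this]
  simp [history]

theorem answer_history_succ (a : ℕ → Bool) (tbl : List Bool → ℕ → Bool) (z : List Bool) (t : ℕ) :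
    answer a tbl (history z (t + 1)) = tbl z t := by
  have hl : (history z (t + 1)).length = z.length + t + 2 := by simp [history]; omega
  have hf : (history z (t + 1)).flatten = z := by
    simp [history, ← List.flatMap_def]
  have hlast : (history z (t + 1)).getLast? = some [] := by
    rw [history_succ]; simp
  rw [answer, if_pos ⟨hlast, by omega⟩, hl, hf]
  congr 1
  omega

/-- The state (whether the next bit is to be printed, and what has been printed) of the querier
after reading `t` bits of the sequence `c`. -/
def decodeBits (c : ℕ → Bool) : ℕ → Bool × List Bool
  | 0 => (false, [])
  | t + 1 => (!(decodeBits c t).1 && c t,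
      (decodeBits c t).2 ++ if (decodeBits c t).1 then [c t] else [])

/-- The sequence of bits that makes the querier print `l`: each bit of `l` is preceded by a bit `1`,
and zeros follow. -/
def codeBit (l : List Bool) (t : ℕ) : Bool :=
  if t % 2 = 0 then decide (t / 2 < l.length) else l.getD (t / 2) false

theorem decodeBits_codeBit_even (l : List Bool) (i : ℕ) :
    decodeBits (codeBit l) (2 * i) = (false, l.take i) := by
  induction i with
  | zero => simp [decodeBits]
  | succ i ih =>
    have h1 : codeBit l (2 * i) = decide (i < l.length) := by simp [codeBit]
    have h2 : codeBit l (2 * i + 1) = l.getD i false := by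
      rw [codeBit, if_neg (by omega)]
      congr 1
      omega
    rw [show 2 * (i + 1) = 2 * i + 1 + 1 by ring, decodeBits, decodeBits, ih, h1, h2]
    by_cases hi : i < l.length
    · rw [List.take_add_one, List.getD_eq_getElem?_getD, List.getElem?_eq_getElem hi]
      simp only [hi, decide_true, Bool.not_false, Bool.true_and, Bool.not_true, Bool.false_and,
        if_true, Bool.false_eq_true, if_false, List.append_nil, Option.getD_some,
        Option.toList_some]
    · rw [List.take_of_length_le (by omega), List.take_of_length_le (by omega)]
      have : l.getD i false = false := List.getD_eq_default _ _ (not_lt.1 hi)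
      rw [this]
      simp [not_lt.1 hi]

theorem decodeBits_codeBit (l : List Bool) {t : ℕ} (ht : 2 * l.length ≤ t) :
    (decodeBits (codeBit l) t).2 = l := by
  rcases Nat.even_or_odd' t with ⟨i, rfl | rfl⟩
  · rw [decodeBits_codeBit_even, List.take_of_length_le (by omega)]
  · rw [decodeBits, decodeBits_codeBit_even, List.take_of_length_le (by omega)]
    simp

namespace querier

variable {k : ℕ}

/-- The situation after `j` bits of the masked input have been sent. Channel `i` carries the masks of
the other channel. -/
theorem sent_reading (a : Fin 2 → ℕ → Bool) (tbl : Fin 2 → List Bool → ℕ → Bool) (x : List Bool)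
    (ρ : ℕ → Bool) {j : ℕ} (hj : j ≤ x.length) :
    let c := (querier k).runFor (fun i ys => [answer (a i) (tbl i) ys]) x ρ (j + 1)
    c.sent = (fun i => history ((mask (a i.rev) x).take j) 0) ∧
      received c = (fun i => a i j) ∧ c.output = [] := by
  induction j with
  | zero =>
    obtain ⟨-, h2, h3, h4⟩ := init_step (k := k) (fun i ys => [answer (a i) (tbl i) ys]) x ρ
    refine ⟨h2, ?_, h4⟩
    funext i
    rw [received, h3]
    exact answer_history_zero _ _ []
  | succ j ih =>
    obtain ⟨h1, h2, h3⟩ := ih (by omega)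
    obtain ⟨-, h5, h6, h7⟩ := (reading_runFor (k := k) (fun i ys => [answer (a i) (tbl i) ys]) x ρ
      (j := j) (by omega)).step (by omega) (fun i ys => [answer (a i) (tbl i) ys])
    rw [← Machine.runFor_succ] at h5 h6 h7
    rw [h1, h2] at h5
    have hs : ((querier k).runFor (fun i ys => [answer (a i) (tbl i) ys]) x ρ (j + 1 + 1)).sent =
        fun i => history ((mask (a i.rev) x).take (j + 1)) 0 := by
      rw [h5]
      funext i
      rw [← history_concat, List.take_add_one, List.getElem?_eq_getElem (by simp; omega)]
      simp [mask]
    refine ⟨hs, ?_, h7.trans h3⟩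
    funext i
    rw [received, h6, hs]
    simp only [answer_history_zero, List.head?_cons, Option.getD_some, List.length_take, length_mask]
    rw [min_eq_left hj]

/-- The situation after the `t + 1`-st empty message that follows the masked input. -/
theorem sent_ticking (a : Fin 2 → ℕ → Bool) (tbl : Fin 2 → List Bool → ℕ → Bool) (x : List Bool)
    (ρ : ℕ → Bool) (z : Fin 2 → List Bool) (hz : z = fun i => mask (a i.rev) x)
    (bits : ℕ → Bool) (hbits : bits = fun t => xor (tbl 0 (z 0) t) (tbl 1 (z 1) t))
    {t : ℕ} (ht : t < (x.length + 2) ^ k) :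
    let c := (querier k).runFor (fun i ys => [answer (a i) (tbl i) ys]) x ρ (x.length + 2 + t)
    (∃ D, digitsValue x.length D + (t + 1) = (x.length + 2) ^ k ∧
      Ticking x.length D (decodeBits bits t).1 c) ∧
      c.sent = (fun i => history (z i) (t + 1)) ∧
      received c = (fun i => tbl i (z i) t) ∧ c.output = (decodeBits bits t).2 := by
  set env : Fin 2 → List (List Bool) → List Bool := fun i ys => [answer (a i) (tbl i) ys] with henv
  induction t with
  | zero =>
    obtain ⟨h1, h2, h3⟩ := sent_reading (k := k) a tbl x ρ le_rfl
    rw [← henv] at h1 h2 h3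
    obtain ⟨h4, h5, h6, h7⟩ := (reading_runFor (k := k) env x ρ le_rfl).finish env
    rw [← Machine.runFor_succ] at h4 h5 h6 h7
    have hs : ((querier k).runFor env x ρ (x.length + 2)).sent = fun i => history (z i) 1 := by
      rw [h5, h1, hz]
      funext i
      dsimp only
      rw [history_succ, List.take_of_length_le (by simp)]
    refine ⟨⟨_, digitsValue_max _ _, h4⟩, hs, ?_, h7.trans h3⟩
    funext i
    rw [received, Nat.add_zero, h6, hs]
    simp only [henv, answer_history_succ, List.head?_cons, Option.getD_some]
  | succ t ih =>
    obtain ⟨⟨D, hD, h⟩, h1, h2, h3⟩ := ih (by omega)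
    have h0 : ¬ ∀ i, D i = 0 := fun h0 => by
      rw [digitsValue_eq_zero.2 h0] at hD
      omega
    have h4 := (h.step env).1
    obtain ⟨h5, h6, h7⟩ := (h.step env).2.2 h0
    rw [← Machine.runFor_succ] at h4 h5 h6 h7
    rw [Nat.add_assoc (x.length + 2) t 1] at h4 h5 h6 h7
    have hb : xor (received ((querier k).runFor env x ρ (x.length + 2 + t)) 0)
        (received ((querier k).runFor env x ρ (x.length + 2 + t)) 1) = bits t := by
      rw [h2, hbits]
    rw [hb] at h4 h5
    have hs : ((querier k).runFor env x ρ (x.length + 2 + (t + 1))).sent =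
        fun i => history (z i) (t + 1 + 1) := by
      rw [h6, h1]
      funext i
      rw [history_succ _ (t + 1)]
    refine ⟨⟨_, ?_, h5⟩, hs, ?_, ?_⟩
    · have := digitsValue_decDigits x.length D h0
      omega
    · funext i
      rw [received, h7, hs]
      simp only [henv, answer_history_succ, List.head?_cons, Option.getD_some]
    · rw [h4, h3]; rfl

theorem run (a : Fin 2 → ℕ → Bool) (tbl : Fin 2 → List Bool → ℕ → Bool) (x : List Bool)
    (ρ : ℕ → Bool) (z : Fin 2 → List Bool) (hz : z = fun i => mask (a i.rev) x)
    (bits : ℕ → Bool) (hbits : bits = fun t => xor (tbl 0 (z 0) t) (tbl 1 (z 1) t)) :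
    let c := (querier k).runFor (fun i ys => [answer (a i) (tbl i) ys]) x ρ
      (x.length + 2 + (x.length + 2) ^ k)
    c.sent = (fun i => history (z i) ((x.length + 2) ^ k)) ∧
      c.output = (decodeBits bits ((x.length + 2) ^ k)).2 := by
  have hpos : 0 < (x.length + 2) ^ k := by positivity
  obtain ⟨t, ht⟩ : ∃ t, (x.length + 2) ^ k = t + 1 := ⟨_, (Nat.succ_pred_eq_of_pos hpos).symm⟩
  obtain ⟨⟨D, hD, h⟩, h1, h2, h3⟩ :=
    sent_ticking (k := k) a tbl x ρ z hz bits hbits (t := t) (by omega)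
  rw [ht, ← Nat.add_assoc, Machine.runFor_succ]
  have h4 := h.step (fun i ys => [answer (a i) (tbl i) ys])
  have h5 := h4.2.1 ((digitsValue_eq_zero (n := x.length)).1 (by omega))
  refine ⟨h5.2.trans h1, ?_⟩
  rw [h4.1, h3, h2]
  simp only [decodeBits, hbits]

end querier

/-! ### Encoding of message sequences -/

theorem encodeMessages_cons (y : List Bool) (ys : List (List Bool)) :
    encodeMessages (y :: ys) = (y.flatMap fun b => [true, b]) ++ false :: encodeMessages ys := by
  simp [encodeMessages]

theorem encodeMessages_injective : Function.Injective encodeMessages := by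
  have aux : ∀ (y y' r r' : List Bool),
      (y.flatMap fun b => [true, b]) ++ false :: r = (y'.flatMap fun b => [true, b]) ++ false :: r' →
        y = y' ∧ r = r' := by
    intro y
    induction y with
    | nil => intro y' r r' h; cases y' <;> simp_all
    | cons b y ih =>
      intro y' r r' h
      cases y' with
      | nil => simp at h
      | cons b' y' =>
        simp only [List.flatMap_cons, List.cons_append, List.nil_append, List.cons.injEq,
          true_and] at h
        obtain ⟨h1, h2⟩ := ih _ _ _ h.2
        exact ⟨by rw [h.1, h1], h2⟩
  intro ys
  induction ys with
  | nil =>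
    intro ys' h
    cases ys' with
    | nil => rfl
    | cons y' ys' => rw [encodeMessages_cons] at h; simp [encodeMessages] at h
  | cons y ys ih =>
    intro ys' h
    cases ys' with
    | nil => rw [encodeMessages_cons] at h; simp [encodeMessages] at h
    | cons y' ys' =>
      rw [encodeMessages_cons, encodeMessages_cons] at h
      obtain ⟨h1, h2⟩ := aux _ _ _ _ h
      rw [h1, ih h2]

/-! ### Coin tosses -/

/-- Independent fair coin tosses remain such if they are read in another order, without repetition,
and some of them are inverted. -/
theorem fairCoins_map_xor_comp {ι κ : Type} (c : κ → Bool) {σ : κ → ι} (hσ : Function.Injective σ) :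
    (fairCoins ι).map (fun s i => xor (c i) (s (σ i))) = fairCoins κ := by
  classical
  refine Measure.eq_infinitePi _ fun I t ht => ?_
  rw [Measure.map_apply (by fun_prop)
    (.pi I.countable_toSet fun i _ => ht i)]
  have hpre : (fun (s : ι → Bool) i => xor (c i) (s (σ i))) ⁻¹' (Set.pi I t) =
      Set.pi (I.image σ : Finset ι) fun j => {b | ∀ i ∈ I, σ i = j → xor (c i) b ∈ t i} := by
    ext s
    simp only [Set.mem_preimage, Set.mem_pi, Finset.mem_coe, Finset.mem_image, Set.mem_ofPred_eq]
    constructor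
    · rintro h _ ⟨i, hi, rfl⟩ i' hi' hii'
      rw [← hii']
      exact h i' hi'
    · intro h i hi
      exact h _ ⟨i, hi, rfl⟩ i hi rfl
  rw [hpre, fairCoins, Measure.infinitePi_pi _ fun _ _ => .of_discrete,
    Finset.prod_image fun _ _ _ _ h => hσ h]
  refine Finset.prod_congr rfl fun i hi => ?_
  have hset : {b | ∀ i' ∈ I, σ i' = σ i → xor (c i') b ∈ t i'} = {b | xor (c i) b ∈ t i} := by
    ext b
    constructor
    · exact fun h => h i hi rfl
    · intro h i' _ hii'
      rw [hσ hii']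
      exact h
  rw [hset]
  -- inverting a fair coin
  have hinv : MeasurePreserving (fun b => xor (c i) b)
      (PMF.uniformOfFintype Bool).toMeasure (PMF.uniformOfFintype Bool).toMeasure := by
    refine ⟨.of_discrete, Measure.ext_of_singleton fun b => ?_⟩
    have hs : (fun b => xor (c i) b) ⁻¹' {b} = {xor (c i) b} := by
      ext b'
      cases c i <;> cases b <;> cases b' <;> simp
    rw [Measure.map_apply .of_discrete .of_discrete, hs]
    simp
  exact hinv.measure_preimage (ht i).nullMeasurableSet

theorem measurable_mask (w : List Bool) : Measurable fun a : ℕ → Bool => mask a w := by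
  have : ∀ (w : List Bool) (d : ℕ), Measurable fun a : ℕ → Bool =>
      w.mapIdx fun j b => xor b (a (j + d)) := by
    intro w
    induction w with
    | nil => exact fun _ => measurable_const
    | cons b w ih =>
      intro d
      have h1 : Measurable fun a : ℕ → Bool => (a d, w.mapIdx fun j b => xor b (a (j + (d + 1)))) :=
        (measurable_pi_apply d).prodMk (ih (d + 1))
      have h2 : Measurable fun p : Bool × List Bool => xor b p.1 :: p.2 := .of_discrete
      convert h2.comp h1 using 2 with a
      simp only [List.mapIdx_cons, Function.comp_apply, Nat.zero_add]
      congr 2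
      funext j b
      rw [show j + 1 + d = j + (d + 1) by ring]
  exact this w 0

/-! ### Independence of the input -/

/-- If the view of player `B i` does not depend on the coins of the querier and its law depends on
the length of the input only, then the scheme leaks at most this length to `B i`. -/
theorem Protocol.leaksAtMost_length {m : ℕ} (S : Protocol m) (i : Fin m)
    (V : List Bool → S.Ω → List (List Bool) × Oracle)
    (hV : ∀ x ω ρ, (S.queries i x ω ρ, S.O i ω) = V x ω) (hm : ∀ x, Measurable (V x))
    (hlaw : ∀ x x', x.length = x'.length → S.P.map (V x) = S.P.map (V x')) :
    S.LeaksAtMost List.length i := by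
  rintro X hX _ ⟨x₀, rfl⟩
  simp only [hV]
  set L : Set (List Bool) := {x | x.length = x₀.length}
  set ν := S.P.prod (fairCoins ℕ)
  set A : Set (List Bool × S.Ω × (ℕ → Bool)) := {e | e.1.length = x₀.length} with hA
  have hAm : MeasurableSet A := measurable_fst (MeasurableSet.of_discrete (s := L))
  have hVm : Measurable fun e : List Bool × S.Ω × (ℕ → Bool) => V e.1 e.2.1 := by
    have : Measurable fun p : S.Ω × List Bool => V p.2 p.1 :=
      measurable_from_prod_countable_left fun x => hm x
    exact this.comp ((measurable_fst.comp measurable_snd).prodMk measurable_fst)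
  have key : ∀ (s : Set (List Bool)) (t : Set (List (List Bool) × Oracle)), MeasurableSet t →
      (X.prod ν) (A ∩ ((fun e => e.1) ⁻¹' s ∩ (fun e => V e.1 e.2.1) ⁻¹' t)) =
        X (L ∩ s) * (S.P.map (V x₀)) t := by
    intro s t ht
    have hms : MeasurableSet (A ∩ ((fun e => e.1) ⁻¹' s ∩ (fun e => V e.1 e.2.1) ⁻¹' t)) :=
      hAm.inter ((measurable_fst (MeasurableSet.of_discrete (s := s))).inter (hVm ht))
    rw [Measure.prod_apply hms]
    have hpt : ∀ x, ν (Prod.mk x ⁻¹' (A ∩ ((fun e => e.1) ⁻¹' s ∩ (fun e => V e.1 e.2.1) ⁻¹' t))) =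
        (L ∩ s).indicator (fun _ => (S.P.map (V x₀)) t) x := by
      intro x
      by_cases hx : x ∈ L ∩ s
      · have : Prod.mk x ⁻¹' (A ∩ ((fun e => e.1) ⁻¹' s ∩ (fun e => V e.1 e.2.1) ⁻¹' t)) =
            (Prod.fst ⁻¹' (V x ⁻¹' t) : Set (S.Ω × (ℕ → Bool))) := by
          ext e
          simp only [Set.mem_preimage, Set.mem_inter_iff, hA, Set.mem_ofPred_eq]
          exact ⟨fun h => h.2.2, fun h => ⟨hx.1, hx.2, h⟩⟩
        rw [this, Set.indicator_of_mem hx, ← hlaw x x₀ hx.1, Measure.map_apply (hm x) ht]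
        exact measurePreserving_fst.measure_preimage (hm x ht).nullMeasurableSet
      · have : Prod.mk x ⁻¹' (A ∩ ((fun e => e.1) ⁻¹' s ∩ (fun e => V e.1 e.2.1) ⁻¹' t)) =
            (∅ : Set (S.Ω × (ℕ → Bool))) := by
          ext e
          simp only [Set.mem_preimage, Set.mem_inter_iff, hA, Set.mem_ofPred_eq,
            Set.mem_empty_iff_false, iff_false]
          exact fun h => hx ⟨h.1, h.2.1⟩
        rw [this, measure_empty, Set.indicator_of_notMem hx]
    simp only [hpt]
    rw [lintegral_indicator .of_discrete, setLIntegral_const, mul_comm]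
  have hprob : ∀ x, IsProbabilityMeasure (S.P.map (V x)) := fun x =>
    Measure.isProbabilityMeasure_map (hm x).aemeasurable
  have hXA : (X.prod ν) A = X L := by
    have := key Set.univ Set.univ .univ
    simpa using this
  rw [indepFun_iff_measure_inter_preimage_eq_mul]
  intro s t _ ht
  have h1 := key s Set.univ .univ
  have h2 := key Set.univ t ht
  simp only [Set.preimage_univ, Set.inter_univ, Set.univ_inter, measure_univ, mul_one] at h1 h2
  rw [cond_apply hAm, cond_apply hAm, cond_apply hAm, key s t ht, h1, h2, hXA]
  rcases eq_or_ne (X L) 0 with h0 | h0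
  · have : X (L ∩ s) = 0 := measure_mono_null Set.inter_subset_left h0
    simp [this]
  · have hinv : (X L)⁻¹ * X L = 1 := ENNReal.inv_mul_cancel h0 (measure_ne_top _ _)
    calc (X L)⁻¹ * (X (L ∩ s) * (S.P.map (V x₀)) t)
        = (X L)⁻¹ * X (L ∩ s) * (((X L)⁻¹ * X L) * (S.P.map (V x₀)) t) := by
          rw [hinv, one_mul, mul_assoc]
      _ = _ := by rw [mul_assoc ((X L)⁻¹) (X L)]

/-! ### The two-oracle scheme -/

namespace TwoOracle

/-- The outcome of the coin tosses from which the oracle tapes are made: the two sequences of masks,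
that of the first player coming first, and the table of the second player. -/
abbrev Coins : Type := ((ℕ → Bool) × (ℕ → Bool)) × (List Bool × ℕ → Bool)

/-- All coins are fair and independent. -/
noncomputable def law : Measure Coins :=
  ((fairCoins ℕ).prod (fairCoins ℕ)).prod (fairCoins (List Bool × ℕ))

instance : IsProbabilityMeasure law := by
  unfold law; infer_instance

/-- The oracle tape on which a player finds its answers to all sequences of messages. At strings that
do not encode a sequence of messages its content is irrelevant. -/
noncomputable def describe (a : ℕ → Bool) (s : List Bool × ℕ → Bool) : Oracle :=
  fun w => answer a (fun z t => s (z, t)) (Function.invFun encodeMessages w)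

theorem describe_encodeMessages (a : ℕ → Bool) (s : List Bool × ℕ → Bool) (ys : List (List Bool)) :
    describe a s (encodeMessages ys) = answer a (fun z t => s (z, t)) ys := by
  rw [describe, Function.leftInverse_invFun encodeMessages_injective]

theorem measurable_describe :
    Measurable fun p : (ℕ → Bool) × (List Bool × ℕ → Bool) => describe p.1 p.2 := by
  refine measurable_pi_lambda _ fun w => ?_
  simp only [describe, answer]
  split_ifs
  · exact (measurable_pi_apply _).comp measurable_snd
  · exact (measurable_pi_apply _).comp measurable_fst

/-- The table of the first player. If `w` is the argument `x` of `f` masked with the second sequence,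
row `w` holds the code of `f x`, xored with that row of the second player's table `s` which belongs
to `x` masked with the first sequence. -/
def twist (f : List Bool → List Bool) (a : (ℕ → Bool) × (ℕ → Bool)) (s : List Bool × ℕ → Bool) :
    List Bool × ℕ → Bool :=
  fun p => xor (codeBit (f (mask a.2 p.1)) p.2) (s (mask a.1 (mask a.2 p.1), p.2))

theorem measurable_twist (f : List Bool → List Bool) :
    Measurable fun ω : Coins => twist f ω.1 ω.2 := by
  refine measurable_pi_lambda _ fun p => ?_
  have h1 : Measurable fun ω : Coins => mask ω.1.2 p.1 :=
    (measurable_mask p.1).comp (measurable_snd.comp measurable_fst)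
  have h2 : Measurable fun ω : Coins => mask ω.1.1 (mask ω.1.2 p.1) := by
    have : Measurable fun q : (ℕ → Bool) × List Bool => mask q.1 q.2 :=
      measurable_from_prod_countable_left fun w => measurable_mask w
    exact this.comp ((measurable_fst.comp measurable_fst).prodMk h1)
  have h3 : Measurable fun ω : Coins => ω.2 (mask ω.1.1 (mask ω.1.2 p.1), p.2) := by
    have : Measurable fun q : (List Bool × ℕ → Bool) × List Bool => q.1 (q.2, p.2) :=
      measurable_from_prod_countable_left fun w => measurable_pi_apply (w, p.2)
    exact this.comp (measurable_snd.prodMk h2)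
  have h4 : Measurable fun q : List Bool × Bool => xor (codeBit (f q.1) p.2) q.2 := .of_discrete
  exact h4.comp (h1.prodMk h3)

/-- The table of the first player is as random as that of the second one. -/
theorem measurePreserving_twist (f : List Bool → List Bool) :
    MeasurePreserving (fun ω : Coins => (ω.1, twist f ω.1 ω.2)) law law := by
  refine MeasurePreserving.skew_product (MeasurePreserving.id _) (measurable_twist f) ?_
  refine Filter.Eventually.of_forall fun a => ?_
  refine fairCoins_map_xor_comp (fun p : List Bool × ℕ => codeBit (f (mask a.2 p.1)) p.2)
    (σ := fun p : List Bool × ℕ => (mask a.1 (mask a.2 p.1), p.2)) ?_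
  rintro ⟨w, t⟩ ⟨w', t'⟩ h
  simp only [Prod.mk.injEq] at h ⊢
  refine ⟨?_, h.2⟩
  have := congrArg (fun v => mask a.2 (mask a.1 v)) h.1
  simpa only [mask_mask] using this

/-- The translation of a sequence that turns a mask of `x` into a mask of `x'`. -/
def shift (x x' : List Bool) (a : ℕ → Bool) (j : ℕ) : Bool :=
  xor (xor (x.getD j false) (x'.getD j false)) (a j)

theorem measurePreserving_shift (x x' : List Bool) :
    MeasurePreserving (shift x x') (fairCoins ℕ) (fairCoins ℕ) :=
  ⟨measurable_pi_lambda _ fun j =>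
      (Measurable.of_discrete (f := fun b => xor (xor (x.getD j false) (x'.getD j false)) b)).comp
        (measurable_pi_apply j),
    fairCoins_map_xor_comp _ Function.injective_id⟩

theorem mask_shift {x x' : List Bool} (h : x.length = x'.length) (a : ℕ → Bool) :
    mask (shift x x' a) x = mask a x' := by
  refine List.ext_getElem (by simpa using h) fun i h1 h2 => ?_
  rw [length_mask] at h1 h2
  simp only [mask, List.getElem_mapIdx, shift, List.getD_eq_getElem?_getD,
    List.getElem?_eq_getElem h1, List.getElem?_eq_getElem h2, Option.getD_some]
  cases x[i] <;> cases x'[i] <;> cases a i <;> rfl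

/-- The contents of the oracle tapes. -/
noncomputable def tape (f : List Bool → List Bool) (i : Fin 2) (ω : Coins) : Oracle :=
  if i = 0 then describe ω.1.1 (twist f ω.1 ω.2) else describe ω.1.2 ω.2

/-- The scheme for `f` in which the querier receives `(|x| + 2) ^ k` bits of the code of `f x`. -/
noncomputable def scheme (f : List Bool → List Bool) (k : ℕ) : Protocol 2 where
  A := querier k
  time := Polynomial.X + 2 + (Polynomial.X + 2) ^ k
  runsInTime env x ρ := by
    simpa using querier.halted_runFor (k := k) env x ρ
  Ω := Coins
  P := law
  O := tape f
  measurable_O i := by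
    unfold tape
    split_ifs
    · exact measurable_describe.comp
        ((measurable_fst.comp measurable_fst).prodMk (measurable_twist f))
    · exact measurable_describe.comp
        ((measurable_snd.comp measurable_fst).prodMk measurable_snd)
  B := fun _ => askInput
  total _ _ _ := askInput_halts _ _

theorem scheme_run (f : List Bool → List Bool) (k : ℕ) (x : List Bool) (ω : Coins) (ρ : ℕ → Bool) :
    ((scheme f k).final x ω ρ).sent = (fun i =>
        history (mask (if i = 0 then ω.1.2 else ω.1.1) x) ((x.length + 2) ^ k)) ∧
      ((scheme f k).final x ω ρ).output =
        (decodeBits (codeBit (f x)) ((x.length + 2) ^ k)).2 := by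
  let a : Fin 2 → ℕ → Bool := fun i => if i = 0 then ω.1.1 else ω.1.2
  let tbl : Fin 2 → List Bool → ℕ → Bool := fun i z t =>
    if i = 0 then twist f ω.1 ω.2 (z, t) else ω.2 (z, t)
  have hreply : (scheme f k).reply ω = fun i ys => [answer (a i) (tbl i) ys] := by
    funext i ys
    have h1 : (scheme f k).reply ω i ys = [tape f i ω (encodeMessages ys)] := askInput_output _ _
    rw [h1, tape]
    by_cases hi : i = 0
    · simp only [hi, if_true, describe_encodeMessages, a, tbl]
    · simp only [hi, if_false, describe_encodeMessages, a, tbl]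
  have htime : (scheme f k).time.eval x.length = x.length + 2 + (x.length + 2) ^ k := by
    simp [scheme]
  have hcode : codeBit (f x) = fun t => xor (tbl 0 (mask (a (Fin.rev 0)) x) t)
      (tbl 1 (mask (a (Fin.rev 1)) x) t) := by
    funext t
    have h0 : a (Fin.rev 0) = ω.1.2 := rfl
    have h1 : a (Fin.rev 1) = ω.1.1 := rfl
    rw [h0, h1]
    simp [tbl, twist, mask_mask]
  have h := querier.run (k := k) a tbl x ρ _ rfl _ hcode
  have hfinal : (scheme f k).final x ω ρ = (scheme f k).A.runFor ((scheme f k).reply ω) x ρ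
      ((scheme f k).time.eval x.length) := rfl
  rw [hfinal, htime, hreply]
  refine ⟨h.1.trans ?_, h.2⟩
  funext i
  fin_cases i <;> rfl

theorem scheme_computes {f : List Bool → List Bool} {k : ℕ}
    (h : ∀ x, 2 * (f x).length ≤ (x.length + 2) ^ k) : (scheme f k).Computes f := by
  intro x ω ρ
  rw [(scheme_run f k x ω ρ).2, decodeBits_codeBit _ (h x)]

theorem measurable_history_mask (x : List Bool) (T : ℕ) :
    Measurable fun a : ℕ → Bool => history (mask a x) T :=
  (Measurable.of_discrete (f := fun z : List Bool => history z T)).comp (measurable_mask x)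

/-- The first player sees the first sequence, its table, and the input masked with the second
sequence. -/
theorem scheme_leaksAtMost_zero (f : List Bool → List Bool) (k : ℕ) :
    (scheme f k).LeaksAtMost List.length 0 := by
  -- the view as a function of the coins after `twist`, where the table is uniform and independent
  -- of the second sequence
  let W : List Bool → Coins → List (List Bool) × Oracle := fun x ω =>
    (history (mask ω.1.2 x) ((x.length + 2) ^ k), describe ω.1.1 ω.2)
  have hW : ∀ x, Measurable (W x) := fun x =>
    ((measurable_history_mask x _).comp (measurable_snd.comp measurable_fst)).prodMk
      (measurable_describe.comp ((measurable_fst.comp measurable_fst).prodMk measurable_snd))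
  refine Protocol.leaksAtMost_length (scheme f k) 0
    (fun x (ω : Coins) => W x (ω.1, twist f ω.1 ω.2)) ?_ ?_ ?_
  · intro x ω ρ
    rw [Protocol.queries, (scheme_run f k x ω ρ).1]
    rfl
  · exact fun x => (hW x).comp (measurePreserving_twist f).measurable
  · intro x x' hx
    have h1 : ∀ x, law.map (fun ω : Coins => W x (ω.1, twist f ω.1 ω.2)) = law.map (W x) := by
      intro x
      conv_rhs => rw [← (measurePreserving_twist f).map_eq]
      rw [Measure.map_map (hW x) (measurePreserving_twist f).measurable]
      rfl
    have h2 : MeasurePreserving (fun ω : Coins => ((ω.1.1, shift x x' ω.1.2), ω.2)) law law :=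
      (((MeasurePreserving.id _).prod (measurePreserving_shift x x')).prod (MeasurePreserving.id _))
    have h3 : law.map (W x) = law.map (W x') := by
      conv_lhs => rw [← h2.map_eq]
      rw [Measure.map_map (hW x) h2.measurable]
      congr 1
      funext ω
      simp only [W, Function.comp_apply, mask_shift hx, hx]
    exact (h1 x).trans (h3.trans (h1 x').symm)

/-- The second player sees the second sequence, its table, and the input masked with the first
sequence. -/
theorem scheme_leaksAtMost_one (f : List Bool → List Bool) (k : ℕ) :
    (scheme f k).LeaksAtMost List.length 1 := by
  let W : List Bool → Coins → List (List Bool) × Oracle := fun x ω =>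
    (history (mask ω.1.1 x) ((x.length + 2) ^ k), describe ω.1.2 ω.2)
  have hW : ∀ x, Measurable (W x) := fun x =>
    ((measurable_history_mask x _).comp (measurable_fst.comp measurable_fst)).prodMk
      (measurable_describe.comp ((measurable_snd.comp measurable_fst).prodMk measurable_snd))
  refine Protocol.leaksAtMost_length (scheme f k) 1 W ?_ hW ?_
  · intro x ω ρ
    rw [Protocol.queries, (scheme_run f k x ω ρ).1]
    rfl
  · intro x x' hx
    have h2 : MeasurePreserving (fun ω : Coins => ((shift x x' ω.1.1, ω.1.2), ω.2)) law law :=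
      (((measurePreserving_shift x x').prod (MeasurePreserving.id _)).prod (MeasurePreserving.id _))
    change law.map (W x) = law.map (W x')
    conv_lhs => rw [← h2.map_eq]
    rw [Measure.map_map (hW x) h2.measurable]
    congr 1
    funext ω
    simp only [W, Function.comp_apply, mask_shift hx, hx]

end TwoOracle

theorem hasInstanceHidingScheme_two {f : List Bool → List Bool} (hf : PolynomiallyBoundedOutput f) :
    HasInstanceHidingScheme 2 f := by
  obtain ⟨p, hp⟩ := hf
  obtain ⟨k, hk⟩ := (2 * p).exists_eval_le_pow
  refine ⟨TwoOracle.scheme f k, TwoOracle.scheme_computes fun x => ?_, fun i => ?_⟩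
  · have := hk x.length
    simp only [Polynomial.eval_mul, Polynomial.eval_ofNat] at this
    exact (Nat.mul_le_mul_left 2 (hp x)).trans this
  · fin_cases i
    · exact TwoOracle.scheme_leaksAtMost_zero f k
    · exact TwoOracle.scheme_leaksAtMost_one f k

theorem mainTheorem8 :
    (∀ f : List Bool → List Bool, PolynomiallyBoundedOutput f → HasInstanceHidingScheme 2 f) ∧
      (∀ᵐ f : List Bool → Bool ∂(fairCoins (List Bool)),
        ¬ HasInstanceHidingScheme 1 (fun x => [f x])) :=
  ⟨fun _ hf => hasInstanceHidingScheme_two hf, ae_not_hasInstanceHidingScheme_one⟩
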